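/- Throughout, $\mathcal X,\mathcal S$ are finite nonempty sets, $\mathcal H_B$ is a finite-dimensional Hilbert space, logarithms are to base $2$, and $\{A\succeq 0\}$ denotes the projection onto the span of the eigenvectors with nonnegative eigenvalue of a Hermitian operator $A$. For a sequence $\{(U^n,S^n)\}_{n\ge1}$ of pairs of finite-valued random variables put $$\overline{\mathbf I}[\mathbf U;\mathbf S]=\inf\Big\{a\in\mathbb R:\ \lim_{n\to\infty}\Pr\Big\{\tfrac1n\log\tfrac{p_{U^nS^n}(U^n,S^n)}{p_{U^n}(U^n)\,p_{S^n}(S^n)}>a+\gamma\Big\}=0\ \text{ for all }\gamma>0\Big\},$$ and for a sequence of bipartite states $\Theta^{U^nB^n}$ with marginals $\Theta^{U^n},\Theta^{B^n}$ put $$\underline{\mathbf I}[\mathbf U;\mathbf B]=\sup\Big\{a\in\mathbb R:\ \lim_{n\to\infty}\mathrm{Tr}\big[\{\Theta^{U^nB^n}-2^{n(a-\gamma)}\,\Theta^{U^n}\otimes\Theta^{B^n}\succeq0\}\,\Theta^{U^nB^n}\big]=1\ \text{ for all }\gamma>0\Big\}.$$ (a) Let $\{\rho^{B^n}_{x^n}\}_{x^n\in\mathcal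 X^n}$, $n\ge1$, be an arbitrary sequence of classical-quantum channels, with $\rho^{B^n}_{x^n}$ a density operator on $\mathcal H_B^{\otimes n}$. An $(n,M_n,\varepsilon_n)$ code consists of a (possibly randomized) encoder $f_n:[1:M_n]\to\mathcal X^n$ and a POVM $\{\beta(m)\}_{m\in[1:M_n]}$ on $\mathcal H_B^{\otimes n}$ with $\frac1{M_n}\sum_m\mathbb E\,\mathrm{Tr}\big[(\mathbb I-\beta(m))\,\rho^{B^n}_{f_n(m)}\big]\le\varepsilon_n$. A rate $R\in\mathbb R$ is achievable if for every $\varepsilon>0$ there is a sequence of $(n,M_n,\varepsilon_n)$ codes with $\liminf_{n}\frac1n\log M_n>R$ and $\limsup_n\varepsilon_n<\varepsilon$; the capacity $C$ is the supremum of the achievable rates. Then $$C=\sup_{\{X^n\}_{n=1}^\infty}\underline{\mathbf I}[\mathbf X;\mathbf B],$$ the supremum being over all sequences of random variables $X^n$ with values in $\mathcal X^n$, and $\underline{\mathbf I}[\mathbf X;\mathbf B]$ being calculated for the states $\sum_{x^n}p_{X^n}(x^n)\,|x^n\rangle\langle x^n|\otimes\rho^{B^n}_{x^n}$. (b) Let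 $\{\rho^{B^n}_{x^n,s^n}\}_{x^n\in\mathcal X^n,\,s^n\in\mathcal S^n}$, $n\ge1$, be an arbitrary sequence of classical-quantum Gel'fand–Pinsker channels, with $\rho^{B^n}_{x^n,s^n}$ a density operator on $\mathcal H_B^{\otimes n}$, whose channel state is a given arbitrary sequence of random variables $S^n\sim p_{S^n}$ on $\mathcal S^n$, and let $s^n$ be known in full (non-causally) at the encoder. That is, an $(n,M_n,\varepsilon_n)$ code consists of a (possibly randomized) encoder $f_n:[1:M_n]\times\mathcal S^n\to\mathcal X^n$ and a POVM $\{\beta(m)\}_{m\in[1:M_n]}$ with $$\frac1{M_n}\sum_m\sum_{s^n}p_{S^n}(s^n)\,\mathbb E\,\mathrm{Tr}\big[(\mathbb I-\beta(m))\,\rho^{B^n}_{f_n(m,s^n),s^n}\big]\le\varepsilon_n,$$ and achievable rates and the capacity $C$ are defined from such codes as in (a). Then $$C=\sup_{\{\Theta_n\}_{n=1}^\infty}\big(\underline{\mathbf I}[\mathbf U;\mathbf B]-\overline{\mathbf I}[\mathbf U;\mathbf S]\big),$$ the supremum being over all sequences of states of the form $$\Theta_n=\sum_{s^n,u^n,x^n}p_{S^n}(s^n)\,p_{U^n\mid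 S^n}(u^n\mid s^n)\,p_{X^n\mid U^nS^n}(x^n\mid u^n,s^n)\,|s^n\rangle\langle s^n|\otimes|u^n\rangle\langle u^n|\otimes|x^n\rangle\langle x^n|\otimes\rho^{B^n}_{x^n,s^n},$$ where $U^n$ takes values in an arbitrary finite set (which may depend on $n$), $p_{U^n\mid S^n}$ and $p_{X^n\mid U^nS^n}$ are arbitrary conditional distributions, and the two quantities are calculated for the reduced states $\Theta^{U^nB^n}=\mathrm{Tr}_{S^nX^n}\Theta_n$ and the joint law of $(U^n,S^n)$. -/

import Mathlib

noncomputable section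

namespace CQ

open Filter Topology
open scoped Kronecker ComplexOrder

/-! ### Operators on finite-dimensional Hilbert spaces -/

/-- Density matrices: positive semidefinite operators of trace one. -/
def IsDensity {d : Type*} [Fintype d] (ρ : Matrix d d ℂ) : Prop :=
  ρ.PosSemidef ∧ ρ.trace = 1

/-- The projection `{A ⪰ 0}` onto the span of the eigenvectors of the Hermitian matrix `A`
with nonnegative eigenvalue, i.e. the functional calculus of the indicator of `[0, ∞)`. -/
def nonnegProj {d : Type*} [Fintype d] [DecidableEq d] (A : Matrix d d ℂ) : Matrix d d ℂ :=
  cfc (Set.indicator (Set.Ici (0 : ℝ)) (fun _ => (1 : ℝ))) A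

/-- Partial trace over the second tensor factor. -/
def traceSnd {d e : Type*} [Fintype e] (τ : Matrix (d × e) (d × e) ℂ) : Matrix d d ℂ :=
  Matrix.of fun i i' => ∑ j, τ (i, j) (i', j)

/-- Partial trace over the first tensor factor. -/
def traceFst {d e : Type*} [Fintype d] (τ : Matrix (d × e) (d × e) ℂ) : Matrix e e ℂ :=
  Matrix.of fun j j' => ∑ i, τ (i, j) (i, j')

/-- The rank one projection `|i⟩⟨i|` on a basis vector. -/
def ketbra {d : Type*} [DecidableEq d] (i : d) : Matrix d d ℂ := Matrix.single i i 1

/-! ### Information-spectrum quantities -/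

/-- The spectral-sup mutual information rate of a sequence of pairs of finite-valued random
variables, given by their joint distributions. -/
def spectralSupMI {α β : ℕ → Type*} [∀ n, Fintype (α n)] [∀ n, Fintype (β n)]
    (p : ∀ n, α n → β n → ℝ) : EReal :=
  sInf ((fun a : ℝ => (a : EReal)) '' {a : ℝ | ∀ γ : ℝ, 0 < γ →
    Tendsto (fun n : ℕ => ∑ u, ∑ s,
      (if a + γ < 1 / (n : ℝ) * Real.logb 2 (p n u s / ((∑ s', p n u s') * (∑ u', p n u' s)))
        then p n u s else 0)) atTop (𝓝 0)})

/-- The spectral-inf rate `I̲[ρ; σ]` of two sequences of operators. -/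
def spectralInf {d : ℕ → Type*} [∀ n, Fintype (d n)] [∀ n, DecidableEq (d n)]
    (ρ σ : ∀ n, Matrix (d n) (d n) ℂ) : EReal :=
  sSup ((fun a : ℝ => (a : EReal)) '' {a : ℝ | ∀ γ : ℝ, 0 < γ →
    Tendsto (fun n : ℕ =>
      (nonnegProj (ρ n - ((2 : ℝ) ^ ((n : ℝ) * (a - γ))) • σ n) * ρ n).trace.re)
      atTop (𝓝 1)})

/-- The spectral-inf mutual information rate of a sequence of bipartite states: the rate
`I̲[τ^{UB}; τ^U ⊗ τ^B]`. -/
def spectralInfMI {d e : ℕ → Type*} [∀ n, Fintype (d n)] [∀ n, DecidableEq (d n)]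
    [∀ n, Fintype (e n)] [∀ n, DecidableEq (e n)]
    (τ : ∀ n, Matrix (d n × e n) (d n × e n) ℂ) : EReal :=
  spectralInf τ (fun n => traceSnd (τ n) ⊗ₖ traceFst (τ n))

/-! ### Classical-quantum channels without state -/

/-- A code with `M` messages for `n` uses of a classical-quantum channel: a (possibly
randomized) encoder, `enc m x` being the probability that message `m` is sent as `x`, and a
decoding POVM. -/
structure CQCode (X B : Type*) [Fintype X] [Fintype B] [DecidableEq B] (n M : ℕ) where
  enc : Fin M → (Fin n → X) → ℝ
  enc_mem : ∀ m, enc m ∈ stdSimplex ℝ (Fin n → X)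
  dec : Fin M → Matrix (Fin n → B) (Fin n → B) ℂ
  dec_pos : ∀ m, (dec m).PosSemidef
  dec_sum : ∑ m, dec m = 1

/-- Average probability of error of a code over the channel `x ↦ ρ x`. -/
def CQCode.error {X B : Type*} [Fintype X] [Fintype B] [DecidableEq B] {n M : ℕ}
    (c : CQCode X B n M) (ρ : (Fin n → X) → Matrix (Fin n → B) (Fin n → B) ℂ) : ℝ :=
  1 / (M : ℝ) * ∑ m, ∑ x, c.enc m x * ((1 - c.dec m) * ρ x).trace.re

/-- The rate `R` is achievable: for every `ε > 0` there is a sequence of `(n, Mₙ, εₙ)` codes with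
`liminf (1/n) log Mₙ > R` and `limsup εₙ < ε`. -/
def CQAchievable {X B : Type*} [Fintype X] [Fintype B] [DecidableEq B]
    (ρ : ∀ n, (Fin n → X) → Matrix (Fin n → B) (Fin n → B) ℂ) (R : ℝ) : Prop :=
  ∀ ε : ℝ, 0 < ε → ∃ (M : ℕ → ℕ) (e : ℕ → ℝ) (c : ∀ n, CQCode X B n (M n)),
    (∀ n, 0 < M n) ∧ (∀ n, (c n).error (ρ n) ≤ e n) ∧
    (R : EReal) < liminf (fun n : ℕ => ((1 / (n : ℝ) * Real.logb 2 (M n) : ℝ) : EReal)) atTop ∧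
    limsup (fun n : ℕ => (e n : EReal)) atTop < (ε : EReal)

/-- The capacity: the supremum of the achievable rates. -/
def cqCapacity {X B : Type*} [Fintype X] [Fintype B] [DecidableEq B]
    (ρ : ∀ n, (Fin n → X) → Matrix (Fin n → B) (Fin n → B) ℂ) : EReal :=
  sSup ((fun R : ℝ => (R : EReal)) '' {R : ℝ | CQAchievable ρ R})

/-- The state `∑ₓ p(x) |x⟩⟨x| ⊗ ρₓ`. -/
def cqState {A B : Type*} [Fintype A] [DecidableEq A] (p : A → ℝ) (ρ : A → Matrix B B ℂ) :
    Matrix (A × B) (A × B) ℂ :=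
  ∑ x, p x • (ketbra x ⊗ₖ ρ x)

/-! ### Gel'fand–Pinsker channels with the state available at the encoder -/

/-- A code with `M` messages for `n` uses of a classical-quantum Gel'fand–Pinsker channel whose
whole state sequence is known to the encoder: a (possibly randomized) encoder, `enc m s x` being
the probability that message `m` is sent as `x` when the state sequence is `s`, and a decoding
POVM. -/
structure GPCode (X S B : Type*) [Fintype X] [Fintype B] [DecidableEq B] (n M : ℕ) where
  enc : Fin M → (Fin n → S) → (Fin n → X) → ℝ
  enc_mem : ∀ m s, enc m s ∈ stdSimplex ℝ (Fin n → X)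
  dec : Fin M → Matrix (Fin n → B) (Fin n → B) ℂ
  dec_pos : ∀ m, (dec m).PosSemidef
  dec_sum : ∑ m, dec m = 1

/-- Probability of error of a code, averaged over the messages and the state sequence. -/
def GPCode.error {X S B : Type*} [Fintype X] [Fintype S] [Fintype B] [DecidableEq B] {n M : ℕ}
    (c : GPCode X S B n M)
    (ρ : (Fin n → X) → (Fin n → S) → Matrix (Fin n → B) (Fin n → B) ℂ)
    (pS : (Fin n → S) → ℝ) : ℝ :=
  1 / (M : ℝ) * ∑ m, ∑ s, pS s * ∑ x, c.enc m s x * ((1 - c.dec m) * ρ x s).trace.re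

/-- The rate `R` is achievable: for every `ε > 0` there is a sequence of `(n, Mₙ, εₙ)` codes with
`liminf (1/n) log Mₙ > R` and `limsup εₙ < ε`. -/
def GPAchievable {X S B : Type*} [Fintype X] [Fintype S] [Fintype B] [DecidableEq B]
    (ρ : ∀ n, (Fin n → X) → (Fin n → S) → Matrix (Fin n → B) (Fin n → B) ℂ)
    (pS : ∀ n, (Fin n → S) → ℝ) (R : ℝ) : Prop :=
  ∀ ε : ℝ, 0 < ε → ∃ (M : ℕ → ℕ) (e : ℕ → ℝ) (c : ∀ n, GPCode X S B n (M n)),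
    (∀ n, 0 < M n) ∧ (∀ n, (c n).error (ρ n) (pS n) ≤ e n) ∧
    (R : EReal) < liminf (fun n : ℕ => ((1 / (n : ℝ) * Real.logb 2 (M n) : ℝ) : EReal)) atTop ∧
    limsup (fun n : ℕ => (e n : EReal)) atTop < (ε : EReal)

/-- The capacity: the supremum of the achievable rates. -/
def gpCapacity {X S B : Type*} [Fintype X] [Fintype S] [Fintype B] [DecidableEq B]
    (ρ : ∀ n, (Fin n → X) → (Fin n → S) → Matrix (Fin n → B) (Fin n → B) ℂ)
    (pS : ∀ n, (Fin n → S) → ℝ) : EReal :=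
  sSup ((fun R : ℝ => (R : EReal)) '' {R : ℝ | GPAchievable ρ pS R})

/-- The free part of a state `Θₙ`: a finite alphabet `{1, …, k}` for `Uⁿ`, and the conditional
distributions `pU s u = p(u | s)` and `pX u s x = p(x | u, s)`. -/
structure AuxInput (X S : Type*) [Fintype X] (n : ℕ) where
  k : ℕ
  pU : (Fin n → S) → Fin k → ℝ
  pU_mem : ∀ s, pU s ∈ stdSimplex ℝ (Fin k)
  pX : Fin k → (Fin n → S) → (Fin n → X) → ℝ
  pX_mem : ∀ u s, pX u s ∈ stdSimplex ℝ (Fin n → X)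

/-- The state
`Θₙ = ∑ p(s) p(u | s) p(x | u, s) |s⟩⟨s| ⊗ |u⟩⟨u| ⊗ |x⟩⟨x| ⊗ ρ_{x,s}`. -/
def AuxInput.theta {X S B : Type*} [Fintype X] [Fintype S] [DecidableEq X] [DecidableEq S]
    {n : ℕ} (a : AuxInput X S n)
    (ρ : (Fin n → X) → (Fin n → S) → Matrix (Fin n → B) (Fin n → B) ℂ)
    (pS : (Fin n → S) → ℝ) :
    Matrix ((Fin n → S) × Fin a.k × (Fin n → X) × (Fin n → B))
      ((Fin n → S) × Fin a.k × (Fin n → X) × (Fin n → B)) ℂ :=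
  ∑ s, ∑ u, ∑ x, (pS s * a.pU s u * a.pX u s x) •
    (ketbra s ⊗ₖ (ketbra u ⊗ₖ (ketbra x ⊗ₖ ρ x s)))

/-- The reduced state `Tr_{Sⁿ Xⁿ} Θ` on `Uⁿ Bⁿ`. -/
def reduceUB {S U X B : Type*} [Fintype S] [Fintype X]
    (Θ : Matrix (S × U × X × B) (S × U × X × B) ℂ) : Matrix (U × B) (U × B) ℂ :=
  Matrix.of fun i j => ∑ s, ∑ x, Θ (s, i.1, x, i.2) (s, j.1, x, j.2)

/-- The joint distribution of `(Uⁿ, Sⁿ)`. -/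
def AuxInput.jointUS {X S : Type*} [Fintype X] {n : ℕ} (a : AuxInput X S n)
    (pS : (Fin n → S) → ℝ) : Fin a.k → (Fin n → S) → ℝ :=
  fun u s => pS s * a.pU s u

end CQ

end

namespace CQ

open Filter Topology
open scoped Kronecker ComplexOrder

/-! ### Traces and the Loewner order -/

section Loewner

open scoped MatrixOrder Matrix.Norms.L2Operator

variable {d : Type*} [Fintype d]

/-! Both formulas follow from matching one-shot bounds stated through the test {τ − c τ^U ⊗ τ^B ⪰ 0}
with c = 2^{n(a−γ)}.

Achievability: codewords are drawn independently and decoded by the square-root measurement built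
from the diagonal blocks of that test. By `hayashi_nagaoka` the mean error is at most twice the
probability that the test rejects τ, plus four times the number of codewords times its acceptance
under the product state, plus a regularisation term. The product acceptance is at most 1/c
(`trace_cqProj_mul_product_le`), so any rate below the spectral-inf rate works. With channel state,
each message owns a bin of L codewords, and the encoder, seeing s, picks one with probability
proportional to q(u,s)/(q(u)q(s)). Once L exceeds the exponential of the spectral-sup rate, the
empirical mean of these ratios rarely drops below one (`codebookMean_likelihood_deficit_le`), and
the decoder faces essentially the conditional states given u. All M·L codewords have to be
decodable, hence the difference of the two rates (`exists_gp_code`).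

Converse: a decoder is itself a test, accepting the joint state with probability one minus the error
and the product state with probability 1/M. Since the projection is an optimal test
(`trace_test_le`), it accepts τ with probability at least 1 − error − c/M. Without state, the test
at input x is the decoder averaged over the posterior of the message; with state, U is the message,
which is independent of S, so the subtracted rate is at most zero. Codes are given for each error
level separately; a diagonal choice of levels merges them into one input sequence. -/

theorem trace_mul_re_nonneg {A C : Matrix d d ℂ} (hA : A.PosSemidef) (hC : C.PosSemidef) :
    0 ≤ (A * C).trace.re := by
  classical
  obtain ⟨a, rfl⟩ := CStarAlgebra.nonneg_iff_eq_star_mul_self.mp hA.nonneg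
  have h := (hC.mul_mul_conjTranspose_same a).trace_nonneg
  rw [Matrix.star_eq_conjTranspose, Matrix.mul_assoc, Matrix.trace_mul_comm]
  exact (Complex.le_def.mp h).1

theorem trace_mul_re_mono {A A' C : Matrix d d ℂ} (h : (A' - A).PosSemidef) (hC : C.PosSemidef) :
    (A * C).trace.re ≤ (A' * C).trace.re := by
  have := trace_mul_re_nonneg h hC
  rw [Matrix.sub_mul, Matrix.trace_sub, Complex.sub_re] at this
  linarith

variable [DecidableEq d]

theorem nonnegProj_posSemidef (A : Matrix d d ℂ) : (nonnegProj A).PosSemidef := by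
  rw [← Matrix.nonneg_iff_posSemidef]
  exact cfc_nonneg fun x _ => Set.indicator_nonneg (fun _ _ => zero_le_one) x

theorem continuousOn_spectrum (f : ℝ → ℝ) (A : Matrix d d ℂ) :
    ContinuousOn f (spectrum ℝ A) :=
  A.finite_real_spectrum.continuousOn f

theorem one_sub_nonnegProj {A : Matrix d d ℂ} (hA : A.IsHermitian) :
    1 - nonnegProj A = cfc (fun x => 1 - (Set.Ici (0 : ℝ)).indicator (fun _ => (1 : ℝ)) x) A := by
  have hA' : IsSelfAdjoint A := hA
  rw [cfc_sub _ _ A (continuousOn_spectrum _ A) (continuousOn_spectrum _ A), cfc_const_one ℝ A,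
    nonnegProj]

theorem one_sub_nonnegProj_posSemidef {A : Matrix d d ℂ} (hA : A.IsHermitian) :
    (1 - nonnegProj A).PosSemidef := by
  rw [← Matrix.nonneg_iff_posSemidef, one_sub_nonnegProj hA]
  exact cfc_nonneg fun x _ => by
    by_cases hx : 0 ≤ x <;> simp [Set.indicator, hx]

theorem nonnegProj_mul_posSemidef {A : Matrix d d ℂ} (hA : A.IsHermitian) :
    (nonnegProj A * A).PosSemidef := by
  have hA' : IsSelfAdjoint A := hA
  have h : nonnegProj A * A
      = cfc (fun x => (Set.Ici (0 : ℝ)).indicator (fun _ => (1 : ℝ)) x * x) A := by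
    rw [cfc_mul _ _ A (continuousOn_spectrum _ A) (continuousOn_spectrum _ A), cfc_id' ℝ A,
      nonnegProj]
  rw [← Matrix.nonneg_iff_posSemidef, h]
  exact cfc_nonneg fun x _ => by
    by_cases hx : 0 ≤ x <;> simp [Set.indicator, hx]

theorem one_sub_nonnegProj_mul_posSemidef {A : Matrix d d ℂ} (hA : A.IsHermitian) :
    ((1 - nonnegProj A) * (-A)).PosSemidef := by
  have hA' : IsSelfAdjoint A := hA
  have h : (1 - nonnegProj A) * (-A)
      = cfc (fun x => (1 - (Set.Ici (0 : ℝ)).indicator (fun _ => (1 : ℝ)) x) * (-x)) A := by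
    rw [cfc_mul _ _ A (continuousOn_spectrum _ A) (continuousOn_spectrum _ A), cfc_neg_id A,
      one_sub_nonnegProj hA]
  rw [← Matrix.nonneg_iff_posSemidef, h]
  exact cfc_nonneg fun x _ => by
    by_cases hx : 0 ≤ x
    · simp [Set.indicator, hx]
    · simp [Set.indicator, hx]; linarith

/-- The projection `{A ⪰ 0}` maximises `Tr T A` over all tests `T`: any test `T` satisfies
`Tr T A ≤ Tr {A ⪰ 0} A`. -/
theorem trace_test_le {A T : Matrix d d ℂ} (hA : A.IsHermitian) (hT : T.PosSemidef)
    (hT' : (1 - T).PosSemidef) : (T * A).trace.re ≤ (nonnegProj A * A).trace.re := by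
  have h1 := trace_mul_re_nonneg hT' (nonnegProj_mul_posSemidef hA)
  have h2 := trace_mul_re_nonneg hT (one_sub_nonnegProj_mul_posSemidef hA)
  -- The gap is the positive part of A tested by 1 − T plus the negative part tested by T.
  have e : (1 - T) * (nonnegProj A * A) + T * ((1 - nonnegProj A) * (-A))
      = nonnegProj A * A - T * A := by noncomm_ring
  have := congrArg (fun M => M.trace.re) e
  simp only [Matrix.trace_add, Matrix.trace_sub, Complex.add_re, Complex.sub_re] at this
  linarith

/-! ### The Hayashi–Nagaoka inequality -/

/-- S and 1 − S commute, so S(1 − S) multiplied by S + (1 − S) = 1 splits into two conjugations of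
positive operators. -/
theorem sub_sq_posSemidef {S : Matrix d d ℂ} (hS : S.PosSemidef) (hS' : (1 - S).PosSemidef) :
    (S - S * S).PosSemidef := by
  have h1 := hS'.mul_mul_conjTranspose_same S
  have h2 := hS.mul_mul_conjTranspose_same (1 - S)
  rw [hS.isHermitian.eq] at h1
  rw [hS'.isHermitian.eq] at h2
  have e : S - S * S = S * (1 - S) * S + (1 - S) * S * (1 - S) := by noncomm_ring
  rw [e]
  exact h1.add h2

/-- The square root is operator monotone and S² ≤ S ≤ S + T. -/
theorem sqrt_sub_posSemidef {S T : Matrix d d ℂ} (hS : S.PosSemidef) (hS' : (1 - S).PosSemidef)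
    (hT : T.PosSemidef) : (CFC.sqrt (S + T) - S).PosSemidef := by
  have h : S * S ≤ S + T := by
    rw [Matrix.le_iff]
    have := (sub_sq_posSemidef hS hS').add hT
    rwa [show S - S * S + T = S + T - S * S by abel] at this
  have := CFC.sqrt_le_sqrt _ _ h
  rwa [CFC.sqrt_mul_self S hS.nonneg, Matrix.le_iff] at this

/-- The inverse square root of a positive definite matrix. -/
noncomputable def invSqrt (G : Matrix d d ℂ) : Matrix d d ℂ := (CFC.sqrt G)⁻¹

theorem invSqrt_isHermitian (G : Matrix d d ℂ) : (invSqrt G).IsHermitian :=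
  (Matrix.nonneg_iff_posSemidef.mp (CFC.sqrt_nonneg G)).isHermitian.inv

theorem isUnit_det_sqrt {G : Matrix d d ℂ} (hG : G.PosDef) : IsUnit (CFC.sqrt G).det := by
  have h : (CFC.sqrt G * CFC.sqrt G).det = G.det := by
    rw [CFC.sqrt_mul_sqrt_self G hG.posSemidef.nonneg]
  have h2 : IsUnit G.det := (Matrix.isUnit_iff_isUnit_det G).mp hG.isUnit
  rw [← h, Matrix.det_mul] at h2
  exact isUnit_of_mul_isUnit_left h2

theorem invSqrt_mul_self {G : Matrix d d ℂ} (hG : G.PosDef) : invSqrt G * G = CFC.sqrt G := by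
  nth_rw 2 [← CFC.sqrt_mul_sqrt_self G hG.posSemidef.nonneg]
  rw [← Matrix.mul_assoc, invSqrt, Matrix.nonsing_inv_mul _ (isUnit_det_sqrt hG), Matrix.one_mul]

theorem self_mul_invSqrt {G : Matrix d d ℂ} (hG : G.PosDef) : G * invSqrt G = CFC.sqrt G := by
  nth_rw 1 [← CFC.sqrt_mul_sqrt_self G hG.posSemidef.nonneg]
  rw [Matrix.mul_assoc, invSqrt, Matrix.mul_nonsing_inv _ (isUnit_det_sqrt hG), Matrix.mul_one]

theorem invSqrt_conj_self {G : Matrix d d ℂ} (hG : G.PosDef) :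
    invSqrt G * G * invSqrt G = 1 := by
  rw [invSqrt_mul_self hG, invSqrt, Matrix.mul_nonsing_inv _ (isUnit_det_sqrt hG)]

theorem invSqrt_conj_posSemidef (G : Matrix d d ℂ) {S : Matrix d d ℂ} (hS : S.PosSemidef) :
    (invSqrt G * S * invSqrt G).PosSemidef := by
  have := hS.mul_mul_conjTranspose_same (invSqrt G)
  rwa [(invSqrt_isHermitian G).eq] at this

/-- With L = (S+T)^{-1/2} and R = (S+T)^{1/2}, the difference equals (L − 2)T(L − 2) + 2(L − 1)S(L −
1) + 4(R − S). The shifts 2 and 1 make the terms LS and SL cancel, and the leftover −4R is absorbed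
by R ≥ S. -/
theorem hayashi_nagaoka {S T : Matrix d d ℂ} (hS : S.PosSemidef) (hS' : (1 - S).PosSemidef)
    (hT : T.PosSemidef) (hST : (S + T).PosDef) :
    ((2 : ℝ) • (1 - S) + (4 : ℝ) • T
      - (1 - invSqrt (S + T) * S * invSqrt (S + T))).PosSemidef := by
  set L := invSqrt (S + T) with hL
  set R := CFC.sqrt (S + T) with hR
  have hLh : L.IsHermitian := invSqrt_isHermitian _
  have e1 : L * (S + T) * L = 1 := invSqrt_conj_self hST
  have e2 : L * (S + T) = R := invSqrt_mul_self hST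
  have e3 : (S + T) * L = R := self_mul_invSqrt hST
  have hone : (1 : Matrix d d ℂ).IsHermitian := Matrix.isHermitian_one
  have h1 := hT.mul_mul_conjTranspose_same (L - (1 + 1))
  rw [(hLh.sub (hone.add hone)).eq] at h1
  have h2 := hS.mul_mul_conjTranspose_same (L - 1)
  rw [(hLh.sub hone).eq] at h2
  have h3 := sqrt_sub_posSemidef hS hS' hT
  have e : (2 : ℝ) • (1 - S) + (4 : ℝ) • T - (1 - L * S * L)
      = (L - (1 + 1)) * T * (L - (1 + 1)) + (2 : ℝ) • ((L - 1) * S * (L - 1))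
        + (4 : ℝ) • (R - S) := by
    have f1 : L * T * L = 1 - L * S * L := by rw [← e1]; noncomm_ring
    have f2 : L * T = R - L * S := by rw [← e2]; noncomm_ring
    have f3 : T * L = R - S * L := by rw [← e3]; noncomm_ring
    have g1 : (L - (1 + 1)) * T * (L - (1 + 1))
        = L * T * L - L * T - L * T - T * L - T * L + T + T + T + T := by noncomm_ring
    have g2 : (L - 1) * S * (L - 1) = L * S * L - L * S - S * L + S := by noncomm_ring
    rw [g1, g2, f1, f2, f3]
    module
  rw [e]
  exact (h1.add (h2.smul (by norm_num))).add (h3.smul (by norm_num))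

end Loewner

/-! ### Expectation over a random codebook -/

section Codebook

variable {U I : Type*} [Fintype U] [Fintype I] [DecidableEq I]

/-- Expectation of `F` over a codebook `I → U` with independent entries distributed as `p`. -/
noncomputable def codebookMean (p : U → ℝ) (F : (I → U) → ℝ) : ℝ :=
  ∑ c, (∏ i, p (c i)) * F c

variable {p : U → ℝ}

theorem codebookMean_add (F G : (I → U) → ℝ) :
    codebookMean p (fun c => F c + G c) = codebookMean p F + codebookMean p G := by
  simp [codebookMean, mul_add, Finset.sum_add_distrib]

theorem codebookMean_const_mul (a : ℝ) (F : (I → U) → ℝ) :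
    codebookMean p (fun c => a * F c) = a * codebookMean p F := by
  simp only [codebookMean, Finset.mul_sum]
  exact Finset.sum_congr rfl fun _ _ => by ring

theorem codebookMean_sum {J : Type*} (s : Finset J) (F : J → (I → U) → ℝ) :
    codebookMean p (fun c => ∑ j ∈ s, F j c) = ∑ j ∈ s, codebookMean p (F j) := by
  simp only [codebookMean, Finset.mul_sum]
  exact Finset.sum_comm

theorem codebookMean_mono (hp : ∀ u, 0 ≤ p u) {F G : (I → U) → ℝ} (h : ∀ c, F c ≤ G c) :
    codebookMean p F ≤ codebookMean p G :=
  Finset.sum_le_sum fun c _ =>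
    mul_le_mul_of_nonneg_left (h c) (Finset.prod_nonneg fun i _ => hp (c i))

/-- Independence of the entries: distributivity turns the sum over codebooks of a product into a
product of sums. The moment formulas below reduce to it. -/
theorem codebookMean_prod (h : I → U → ℝ) :
    codebookMean p (fun c => ∏ i, h i (c i)) = ∏ i, ∑ u, p u * h i u := by
  simp only [codebookMean, ← Finset.prod_mul_distrib]
  exact (Fintype.prod_sum fun i u => p u * h i u).symm

theorem codebookMean_const (hp : ∑ u, p u = 1) (a : ℝ) :
    codebookMean p (fun _ : I → U => a) = a := by
  have h := codebookMean_const_mul (p := p) (I := I) a (fun _ => 1)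
  have h1 := codebookMean_prod (p := p) (fun (_ : I) (_ : U) => (1 : ℝ))
  simp only [mul_one, hp, Finset.prod_const_one] at h h1
  rw [h, h1, mul_one]

theorem codebookMean_mul_coord (hp : ∑ u, p u = 1) {i j : I} (hij : i ≠ j) (f g : U → ℝ) :
    codebookMean p (fun c => f (c i) * g (c j)) = (∑ u, p u * f u) * ∑ u, p u * g u := by
  -- Coordinates other than i and j receive the factor 1 and integrate to the total mass 1.
  have h := codebookMean_prod (p := p)
    (fun k u => (if k = i then f u else 1) * (if k = j then g u else 1))
  simp only [Finset.prod_mul_distrib, Finset.prod_ite_eq', Finset.mem_univ, if_true] at h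
  rw [h]
  have : ∀ k, (∑ u, p u * ((if k = i then f u else 1) * (if k = j then g u else 1)))
      = (if k = i then ∑ u, p u * f u else 1) * (if k = j then ∑ u, p u * g u else 1) := by
    intro k
    by_cases h1 : k = i
    · have h2 : k ≠ j := h1 ▸ hij
      simp [h1, hij]
    · by_cases h2 : k = j <;> simp [h1, h2, hp, Ne.symm hij]
  rw [Finset.prod_congr rfl fun k _ => this k]
  rw [Finset.prod_mul_distrib, Finset.prod_ite_eq', Finset.prod_ite_eq']
  simp

theorem codebookMean_coord (hp : ∑ u, p u = 1) (i : I) (f : U → ℝ) :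
    codebookMean p (fun c => f (c i)) = ∑ u, p u * f u := by
  have h := codebookMean_prod (p := p) (fun k u => if k = i then f u else 1)
  simp only [Finset.prod_ite_eq', Finset.mem_univ, if_true] at h
  rw [h]
  have : ∀ k, (∑ u, p u * (if k = i then f u else 1))
      = if k = i then ∑ u, p u * f u else 1 := by
    intro k
    by_cases h1 : k = i <;> simp [h1, hp]
  rw [Finset.prod_congr rfl fun k _ => this k]
  simp

theorem codebookMean_coord_pair (hp : ∑ u, p u = 1) {i j : I} (hij : i ≠ j) (f : U → U → ℝ) :
    codebookMean p (fun c => f (c i) (c j)) = ∑ u, ∑ v, p u * p v * f u v := by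
  classical
  -- Expanding over the value of the i-th entry writes f as a sum of products of one-coordinate
  -- functions.
  have e : ∀ c : I → U, f (c i) (c j)
      = ∑ u, (if c i = u then 1 else 0) * f u (c j) := fun c => by simp
  simp only [e, codebookMean_sum]
  refine Finset.sum_congr rfl fun u _ => ?_
  rw [codebookMean_mul_coord hp hij (fun w => if w = u then 1 else 0) (f u)]
  simp [Finset.mul_sum, mul_assoc]

theorem exists_le_of_codebookMean_le (hp0 : ∀ u, 0 ≤ p u) (hp : ∑ u, p u = 1)
    {F : (I → U) → ℝ} {K : ℝ} (h : codebookMean p F ≤ K) : ∃ c, F c ≤ K := by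
  by_contra! hc
  have h0 : codebookMean p (fun c => F c + (-K)) ≤ 0 := by
    rw [codebookMean_add, codebookMean_const hp]; linarith
  have hw : ∀ c : I → U, 0 ≤ ∏ i, p (c i) := fun c => Finset.prod_nonneg fun i _ => hp0 (c i)
  -- Weights may vanish, so strictness does not pass to the mean directly. Instead every nonnegative
  -- term is zero, which forces every weight to be zero, against total weight one.
  have hz := (Finset.sum_eq_zero_iff_of_nonneg fun c _ =>
    mul_nonneg (hw c) (by linarith [hc c] : (0 : ℝ) ≤ F c + (-K))).mp
    (le_antisymm h0 (Finset.sum_nonneg fun c _ => mul_nonneg (hw c) (by linarith [hc c])))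
  have h1 := codebookMean_const (I := I) hp 1
  rw [codebookMean, Finset.sum_eq_zero] at h1
  · exact zero_ne_one h1
  · intro c _
    have := (mul_eq_zero.mp (hz c (Finset.mem_univ c))).resolve_right (by linarith [hc c])
    rw [this, zero_mul]

/-- The empirical mean of `L` independent samples has variance at most `E h² / L`. -/
theorem codebookMean_sq_le (hp : ∑ u, p u = 1) {L : ℕ} (hL : 0 < L)
    {e : Fin L → I} (he : Function.Injective e) (h : U → ℝ) :
    codebookMean p (fun c => (∑ u, p u * h u - 1 / (L : ℝ) * ∑ l, h (c (e l))) ^ 2)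
      ≤ 1 / (L : ℝ) * ∑ u, p u * h u ^ 2 := by
  set μ := ∑ u, p u * h u with hμ
  have hL' : (L : ℝ) ≠ 0 := by positivity
  have hcen : ∑ u, p u * (μ - h u) = 0 := by
    simp only [mul_sub, Finset.sum_sub_distrib, ← Finset.sum_mul, hp, one_mul, ← hμ, sub_self]
  have hvar : ∑ u, p u * ((μ - h u) * (μ - h u)) ≤ ∑ u, p u * h u ^ 2 := by
    have : ∑ u, p u * ((μ - h u) * (μ - h u))
        = ∑ u, p u * h u ^ 2 - 2 * μ * ∑ u, p u * h u + μ ^ 2 * ∑ u, p u := by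
      simp only [Finset.mul_sum, ← Finset.sum_sub_distrib, ← Finset.sum_add_distrib]
      exact Finset.sum_congr rfl fun _ _ => by ring
    rw [this, hp, ← hμ]
    nlinarith [sq_nonneg μ]
  have e1 : ∀ c : I → U, (μ - 1 / (L : ℝ) * ∑ l, h (c (e l))) ^ 2
      = (1 / (L : ℝ)) ^ 2 * ∑ l, ∑ l', (μ - h (c (e l))) * (μ - h (c (e l'))) := by
    intro c
    have : μ - 1 / (L : ℝ) * ∑ l, h (c (e l)) = 1 / (L : ℝ) * ∑ l, (μ - h (c (e l))) := by
      simp [Finset.sum_sub_distrib, mul_sub, hL']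
    rw [this, mul_pow, sq (∑ l, (μ - h (c (e l)))), Finset.sum_mul_sum]
  -- Distinct samples sit at distinct entries by injectivity of `e`, so their centred covariances
  -- vanish.
  have e2 : ∀ l l', codebookMean p (fun c => (μ - h (c (e l))) * (μ - h (c (e l'))))
      = if l = l' then ∑ u, p u * ((μ - h u) * (μ - h u)) else 0 := by
    intro l l'
    split_ifs with hl
    · subst hl
      exact codebookMean_coord hp (e l) (fun u => (μ - h u) * (μ - h u))
    · rw [codebookMean_mul_coord hp (he.ne hl) (fun u => μ - h u) (fun u => μ - h u), hcen,
        zero_mul]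
  simp only [e1, codebookMean_const_mul, codebookMean_sum, e2]
  simp only [Finset.sum_ite_eq, Finset.mem_univ, if_true, Finset.sum_const, Finset.card_univ,
    Fintype.card_fin, nsmul_eq_mul]
  calc (1 / (L : ℝ)) ^ 2 * (L * ∑ u, p u * ((μ - h u) * (μ - h u)))
      = 1 / (L : ℝ) * ∑ u, p u * ((μ - h u) * (μ - h u)) := by field_simp
    _ ≤ _ := mul_le_mul_of_nonneg_left hvar (by positivity)

end Codebook

/-! ### Random coding with the square-root measurement -/

section SquareRootMeasurement

variable {d : Type*} [Fintype d] [DecidableEq d]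

theorem trace_one_sub_mul_re {T ρ : Matrix d d ℂ} :
    ((1 - T) * ρ).trace.re = ρ.trace.re - (T * ρ).trace.re := by
  rw [Matrix.sub_mul, Matrix.one_mul, Matrix.trace_sub, Complex.sub_re]

variable {I : Type*} [Fintype I]

/-- The square-root measurement associated with the tests `P i`, with the sum of the tests
regularised by `δ • 1` so that it is invertible. -/
noncomputable def squareRootMeas (P : I → Matrix d d ℂ) (δ : ℝ) (i : I) : Matrix d d ℂ :=
  invSqrt (∑ j, P j + δ • (1 : Matrix d d ℂ)) * P i *
    invSqrt (∑ j, P j + δ • (1 : Matrix d d ℂ))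

variable {P : I → Matrix d d ℂ} {δ : ℝ}

theorem squareRootMeas_posSemidef (hP : ∀ i, (P i).PosSemidef) (i : I) :
    (squareRootMeas P δ i).PosSemidef :=
  invSqrt_conj_posSemidef _ (hP i)

omit [Fintype d] in
theorem posDef_sum_add (hP : ∀ i, (P i).PosSemidef) (hδ : 0 < δ) :
    (∑ j, P j + δ • (1 : Matrix d d ℂ)).PosDef :=
  Matrix.PosDef.posSemidef_add (Matrix.posSemidef_sum _ fun i _ => hP i)
    (Matrix.PosDef.one.smul hδ)

/-- The missing mass is precisely the conjugated regularising term δ • 1. -/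
theorem one_sub_sum_squareRootMeas_posSemidef (hP : ∀ i, (P i).PosSemidef) (hδ : 0 < δ) :
    (1 - ∑ i, squareRootMeas P δ i).PosSemidef := by
  have h := invSqrt_conj_self (posDef_sum_add hP hδ)
  have h2 := invSqrt_conj_posSemidef (∑ j, P j + δ • (1 : Matrix d d ℂ))
    (Matrix.PosSemidef.one.smul hδ.le : (δ • (1 : Matrix d d ℂ)).PosSemidef)
  have e : 1 - ∑ i, squareRootMeas P δ i
      = invSqrt (∑ j, P j + δ • (1 : Matrix d d ℂ)) * (δ • (1 : Matrix d d ℂ))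
        * invSqrt (∑ j, P j + δ • (1 : Matrix d d ℂ)) := by
    nth_rw 1 [← h]
    simp only [squareRootMeas, ← Finset.sum_mul, ← Finset.mul_sum]
    noncomm_ring
  rwa [e]

/-- Hayashi–Nagaoka with S the correct test and T the competing tests plus δ • 1. The regularisation
costs at most 4δ because ρ has trace at most one. -/
theorem squareRootMeas_error_le [DecidableEq I] (hP : ∀ i, (P i).PosSemidef)
    (hP' : ∀ i, (1 - P i).PosSemidef) (hδ : 0 < δ) {ρ : Matrix d d ℂ} (hρ : ρ.PosSemidef)
    (hρ1 : ρ.trace.re ≤ 1) (i : I) :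
    ((1 - squareRootMeas P δ i) * ρ).trace.re ≤ 2 * ((1 - P i) * ρ).trace.re
      + 4 * ∑ j ∈ Finset.univ.erase i, (P j * ρ).trace.re + 4 * δ := by
  set T := ∑ j ∈ Finset.univ.erase i, P j + δ • (1 : Matrix d d ℂ) with hT
  have hsum : ∑ j, P j + δ • (1 : Matrix d d ℂ) = P i + T := by
    rw [hT, ← add_assoc, Finset.add_sum_erase _ _ (Finset.mem_univ i)]
  have hTp : T.PosSemidef := (Matrix.posSemidef_sum _ fun i _ => hP i).add
    (Matrix.PosSemidef.one.smul hδ.le)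
  have hpd := posDef_sum_add hP hδ
  rw [hsum] at hpd
  have h := trace_mul_re_mono (hayashi_nagaoka (hP i) (hP' i) hTp hpd) hρ
  rw [squareRootMeas, hsum]
  refine h.trans ?_
  have e : (((2 : ℝ) • (1 - P i) + (4 : ℝ) • T) * ρ).trace.re
      = 2 * ((1 - P i) * ρ).trace.re
        + 4 * (∑ j ∈ Finset.univ.erase i, (P j * ρ).trace.re + δ * ρ.trace.re) := by
    simp only [hT, Matrix.add_mul, Matrix.trace_add, Matrix.sum_mul, Matrix.trace_sum,
      Matrix.smul_mul, Matrix.trace_smul, Complex.add_re, Complex.re_sum, Complex.smul_re,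
      smul_eq_mul, Matrix.one_mul]
  rw [e]
  nlinarith

end SquareRootMeasurement

/-! ### Averaging the square-root measurement error over codebooks -/

section RandomCoding

variable {d : Type*} [Fintype d] [DecidableEq d]
variable {U I : Type*} [Fintype U] [Fintype I] [DecidableEq I]

/-- Expected error of a random code with the square-root measurement. -/
theorem codebookMean_squareRootMeas_le {p : U → ℝ} (hp0 : ∀ u, 0 ≤ p u) (hp : ∑ u, p u = 1)
    {P ρ : U → Matrix d d ℂ} (hP : ∀ u, (P u).PosSemidef) (hP' : ∀ u, (1 - P u).PosSemidef)
    (hρ : ∀ u, (ρ u).PosSemidef) (hρ1 : ∀ u, (ρ u).trace.re ≤ 1) {δ : ℝ} (hδ : 0 < δ) (i : I) :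
    codebookMean p (fun c => ((1 - squareRootMeas (fun j => P (c j)) δ i) * ρ (c i)).trace.re)
      ≤ 2 * ∑ u, p u * ((1 - P u) * ρ u).trace.re
        + 4 * (Fintype.card I * ∑ u, ∑ v, p u * p v * (P v * ρ u).trace.re) + 4 * δ := by
  refine (codebookMean_mono hp0 fun c =>
    squareRootMeas_error_le (fun j => hP (c j)) (fun j => hP' (c j)) hδ (hρ (c i)) (hρ1 (c i))
      i).trans ?_
  rw [codebookMean_add, codebookMean_add, codebookMean_const hp, codebookMean_const_mul,
    codebookMean_const_mul, codebookMean_sum,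
    codebookMean_coord hp i (fun u => ((1 - P u) * ρ u).trace.re)]
  -- A wrong test is independent of the transmitted codeword, so each competitor contributes the
  -- acceptance under the product law.
  have hcross : ∀ j ∈ Finset.univ.erase i,
      codebookMean p (fun c => (P (c j) * ρ (c i)).trace.re)
        = ∑ u, ∑ v, p u * p v * (P v * ρ u).trace.re := fun j hj =>
    codebookMean_coord_pair hp (Finset.ne_of_mem_erase hj).symm
      (fun u v => (P v * ρ u).trace.re)
  rw [Finset.sum_congr rfl hcross, Finset.sum_const, nsmul_eq_mul]
  have hnn : 0 ≤ ∑ u, ∑ v, p u * p v * (P v * ρ u).trace.re :=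
    Finset.sum_nonneg fun u _ => Finset.sum_nonneg fun v _ =>
      mul_nonneg (mul_nonneg (hp0 u) (hp0 v)) (trace_mul_re_nonneg (hP v) (hρ u))
  have hcard : ((Finset.univ.erase i).card : ℝ) ≤ Fintype.card I := by
    exact_mod_cast (Finset.card_le_univ _)
  have := mul_le_mul_of_nonneg_right hcard hnn
  linarith

end RandomCoding

/-! ### The likelihood encoder -/

section Likelihood

/-- Probability of selecting `l` proportionally to the weights `r`, and uniformly if all the
weights vanish. -/
noncomputable def likelihood {L : ℕ} (r : Fin L → ℝ) (l : Fin L) : ℝ :=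
  if ∑ k, r k = 0 then 1 / (L : ℝ) else r l / ∑ k, r k

variable {L : ℕ} {r : Fin L → ℝ}

theorem likelihood_nonneg (hr : ∀ l, 0 ≤ r l) (l : Fin L) : 0 ≤ likelihood r l := by
  unfold likelihood
  split_ifs
  · positivity
  · exact div_nonneg (hr l) (Finset.sum_nonneg fun k _ => hr k)

theorem sum_likelihood (hL : 0 < L) : ∑ l, likelihood r l = 1 := by
  have hL' : (L : ℝ) ≠ 0 := by positivity
  unfold likelihood
  split_ifs with h
  · simp [hL']
  · rw [← Finset.sum_div, div_self h]

/-- Change of measure from r l / Σ r to r l / L. If m is the mean weight and G the left side, the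
two averages differ by (1 − m)G with 0 ≤ G ≤ 1, so only a deficit of m below one costs anything. -/
theorem sum_likelihood_mul_le (hL : 0 < L) (hr : ∀ l, 0 ≤ r l) {g : Fin L → ℝ}
    (hg0 : ∀ l, 0 ≤ g l) (hg1 : ∀ l, g l ≤ 1) :
    ∑ l, likelihood r l * g l
      ≤ 1 / (L : ℝ) * ∑ l, r l * g l + max 0 (1 - 1 / (L : ℝ) * ∑ l, r l) := by
  have hL' : (0 : ℝ) < L := by positivity
  set R := ∑ l, r l with hR
  have hR0 : 0 ≤ R := Finset.sum_nonneg fun l _ => hr l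
  have hle : ∑ l, likelihood r l * g l ≤ 1 := by
    rw [← sum_likelihood (r := r) hL]
    exact Finset.sum_le_sum fun l _ =>
      mul_le_of_le_one_right (likelihood_nonneg hr l) (hg1 l)
  rcases hR0.eq_or_lt with h0 | h0
  · have : 0 ≤ ∑ l, r l * g l := Finset.sum_nonneg fun l _ => mul_nonneg (hr l) (hg0 l)
    have h1 : (1 : ℝ) ≤ max 0 (1 - 1 / (L : ℝ) * R) := by rw [← h0]; simp
    have h2 : 0 ≤ 1 / (L : ℝ) * ∑ l, r l * g l := by positivity
    linarith
  · have e : ∑ l, r l * g l = R * ∑ l, likelihood r l * g l := by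
      rw [Finset.mul_sum]
      refine Finset.sum_congr rfl fun l _ => ?_
      rw [likelihood, if_neg (by rw [← hR]; exact h0.ne'), ← hR]
      field_simp
    rw [e]
    set G := ∑ l, likelihood r l * g l
    have hG0 : 0 ≤ G := Finset.sum_nonneg fun l _ => mul_nonneg (likelihood_nonneg hr l) (hg0 l)
    have h3 : 1 - 1 / (L : ℝ) * R ≤ max 0 (1 - 1 / (L : ℝ) * R) := le_max_right _ _
    have h4 : (0 : ℝ) ≤ max 0 (1 - 1 / (L : ℝ) * R) := le_max_left _ _
    have h5 : 1 / (L : ℝ) * (R * G) = (1 / (L : ℝ) * R) * G := by ring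
    rw [h5]
    nlinarith [mul_nonneg (sub_nonneg.mpr h3) hG0, mul_nonneg h4 (sub_nonneg.mpr hle)]

end Likelihood

/-! ### Joint distributions and likelihood ratios -/

section Joint

variable {U S : Type*} [Fintype U] [Fintype S]

/-- The likelihood ratio `q(u,s) / (q(u) q(s))` of a joint distribution. -/
noncomputable def likelihoodRatio (q : U → S → ℝ) (u : U) (s : S) : ℝ :=
  q u s / ((∑ s', q u s') * ∑ u', q u' s)

variable {q : U → S → ℝ}

theorem likelihoodRatio_nonneg (hq : ∀ u s, 0 ≤ q u s) (u : U) (s : S) :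
    0 ≤ likelihoodRatio q u s :=
  div_nonneg (hq u s) (mul_nonneg (Finset.sum_nonneg fun _ _ => hq _ _)
    (Finset.sum_nonneg fun _ _ => hq _ _))

/-- Weighting by the law of s turns the ratio into the conditional probability of s given u, which
is how the conditional output state enters the coding argument. Zero marginals are harmless, since q
vanishes with them. -/
theorem marginal_snd_mul_likelihoodRatio (hq : ∀ u s, 0 ≤ q u s) (u : U) (s : S) :
    (∑ u', q u' s) * likelihoodRatio q u s = q u s / ∑ s', q u s' := by
  have hle : q u s ≤ ∑ u', q u' s :=
    Finset.single_le_sum (f := fun u' => q u' s) (fun _ _ => hq _ _) (Finset.mem_univ u)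
  by_cases h : ∑ u', q u' s = 0
  · have : q u s = 0 := le_antisymm (h ▸ hle) (hq u s)
    simp [h, this]
  · rw [likelihoodRatio]; field_simp

theorem marginal_fst_mul_likelihoodRatio (hq : ∀ u s, 0 ≤ q u s) (u : U) (s : S) :
    (∑ s', q u s') * likelihoodRatio q u s = q u s / ∑ u', q u' s := by
  have hle : q u s ≤ ∑ s', q u s' :=
    Finset.single_le_sum (f := fun s' => q u s') (fun _ _ => hq _ _) (Finset.mem_univ s)
  by_cases h : ∑ s', q u s' = 0
  · have : q u s = 0 := le_antisymm (h ▸ hle) (hq u s)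
    simp [h, this]
  · rw [likelihoodRatio]; field_simp

theorem marginals_mul_likelihoodRatio (hq : ∀ u s, 0 ≤ q u s) (u : U) (s : S) :
    (∑ u', q u' s) * ((∑ s', q u s') * likelihoodRatio q u s) = q u s := by
  have hle : q u s ≤ ∑ u', q u' s :=
    Finset.single_le_sum (f := fun u' => q u' s) (fun _ _ => hq _ _) (Finset.mem_univ u)
  rw [marginal_fst_mul_likelihoodRatio hq]
  by_cases h : ∑ u', q u' s = 0
  · have : q u s = 0 := le_antisymm (h ▸ hle) (hq u s)
    simp [h, this]
  · field_simp

/-- The likelihood ratio, set to zero where it exceeds `t`. -/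
noncomputable def truncRatio (q : U → S → ℝ) (t : ℝ) (u : U) (s : S) : ℝ :=
  if t < likelihoodRatio q u s then 0 else likelihoodRatio q u s

theorem truncRatio_le (hq : ∀ u s, 0 ≤ q u s) (t : ℝ) (u : U) (s : S) :
    truncRatio q t u s ≤ likelihoodRatio q u s := by
  unfold truncRatio; split_ifs
  · exact likelihoodRatio_nonneg hq u s
  · exact le_rfl

/-- Averaged over u, this bounds the second moment of the truncated ratio by t times its mean, which
the variance estimate needs. -/
theorem truncRatio_le_bound (hq : ∀ u s, 0 ≤ q u s) {t : ℝ} (u : U) (s : S) :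
    truncRatio q t u s ^ 2 ≤ t * truncRatio q t u s := by
  have := likelihoodRatio_nonneg hq u s
  unfold truncRatio; split_ifs with h
  · simp
  · rw [sq]; exact mul_le_mul_of_nonneg_right (not_lt.mp h) this

theorem sum_mul_truncRatio_le_one (hq : ∀ u s, 0 ≤ q u s) (t : ℝ) (s : S) :
    ∑ u, (∑ s', q u s') * truncRatio q t u s ≤ 1 := by
  calc ∑ u, (∑ s', q u s') * truncRatio q t u s
      ≤ ∑ u, q u s / ∑ u', q u' s := Finset.sum_le_sum fun u _ => by
        rw [← marginal_fst_mul_likelihoodRatio hq]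
        exact mul_le_mul_of_nonneg_left (truncRatio_le hq t u s)
          (Finset.sum_nonneg fun _ _ => hq _ _)
    _ ≤ 1 := by rw [← Finset.sum_div]; exact div_self_le_one _

/-- The mass removed by truncation is exactly the probability that the ratio exceeds t. -/
theorem marginals_mul_truncRatio (hq : ∀ u s, 0 ≤ q u s) (t : ℝ) (u : U) (s : S) :
    (∑ u', q u' s) * ((∑ s', q u s') * truncRatio q t u s)
      = q u s - if t < likelihoodRatio q u s then q u s else 0 := by
  unfold truncRatio; split_ifs
  · simp
  · rw [marginals_mul_likelihoodRatio hq, sub_zero]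

end Joint

/-! ### One-shot achievability -/

section OneShot

variable {d : Type*} [Fintype d] [DecidableEq d]

omit [DecidableEq d] in
theorem IsDensity.trace_re {ρ : Matrix d d ℂ} (h : IsDensity ρ) : ρ.trace.re = 1 := by
  rw [h.2, Complex.one_re]

omit [Fintype d] in
/-- A family of subnormalised tests, completed to a measurement by adding the remainder to one
of the outcomes. -/
theorem exists_measurement_of_sum_le {M : ℕ} (hM : 0 < M) (T : Fin M → Matrix d d ℂ)
    (hT : ∀ m, (T m).PosSemidef) (hT' : (1 - ∑ m, T m).PosSemidef) :
    ∃ β : Fin M → Matrix d d ℂ, (∀ m, (β m).PosSemidef) ∧ ∑ m, β m = 1 ∧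
      ∀ m, (β m - T m).PosSemidef := by
  refine ⟨fun m => T m + if m = ⟨0, hM⟩ then 1 - ∑ m, T m else 0, fun m => ?_, ?_, fun m => ?_⟩
  · dsimp only
    split_ifs
    · exact (hT m).add hT'
    · simpa using hT m
  · rw [Finset.sum_add_distrib, Finset.sum_ite_eq']
    simp
  · dsimp only
    rw [add_sub_cancel_left]
    split_ifs
    · exact hT'
    · exact Matrix.PosSemidef.zero

variable {U : Type*} [Fintype U]

/-- One-shot random coding for a classical-quantum channel. -/
theorem exists_cq_code {p : U → ℝ} (hp0 : ∀ u, 0 ≤ p u) (hp : ∑ u, p u = 1)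
    {P ρ : U → Matrix d d ℂ} (hP : ∀ u, (P u).PosSemidef) (hP' : ∀ u, (1 - P u).PosSemidef)
    (hρ : ∀ u, IsDensity (ρ u)) {δ : ℝ} (hδ : 0 < δ) {M : ℕ} (hM : 0 < M) :
    ∃ (c : Fin M → U) (β : Fin M → Matrix d d ℂ), (∀ m, (β m).PosSemidef) ∧ ∑ m, β m = 1 ∧
      1 / (M : ℝ) * ∑ m, ((1 - β m) * ρ (c m)).trace.re
        ≤ 2 * ∑ u, p u * ((1 - P u) * ρ u).trace.re
          + 4 * (M * ∑ u, ∑ v, p u * p v * (P v * ρ u).trace.re) + 4 * δ := by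
  set K := 2 * ∑ u, p u * ((1 - P u) * ρ u).trace.re
          + 4 * (M * ∑ u, ∑ v, p u * p v * (P v * ρ u).trace.re) + 4 * δ with hK
  have hM' : (M : ℝ) ≠ 0 := by positivity
  have hmean : codebookMean p (fun c : Fin M → U => 1 / (M : ℝ) *
      ∑ m, ((1 - squareRootMeas (fun j => P (c j)) δ m) * ρ (c m)).trace.re) ≤ K := by
    rw [codebookMean_const_mul, codebookMean_sum]
    refine (mul_le_mul_of_nonneg_left (Finset.sum_le_sum fun m _ =>
      codebookMean_squareRootMeas_le hp0 hp hP hP' (fun u => (hρ u).1)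
        (fun u => (hρ u).trace_re.le) hδ m) (by positivity)).trans ?_
    rw [Fintype.card_fin, ← hK, Finset.sum_const, Finset.card_univ, Fintype.card_fin,
      nsmul_eq_mul, ← mul_assoc, one_div_mul_cancel hM', one_mul]
  obtain ⟨c, hc⟩ := exists_le_of_codebookMean_le hp0 hp hmean
  obtain ⟨β, hβ, hβ1, hβT⟩ := exists_measurement_of_sum_le hM
    (squareRootMeas (fun j => P (c j)) δ) (squareRootMeas_posSemidef fun j => hP (c j))
    (one_sub_sum_squareRootMeas_posSemidef (fun j => hP (c j)) hδ)
  refine ⟨c, β, hβ, hβ1, le_trans ?_ hc⟩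
  refine mul_le_mul_of_nonneg_left (Finset.sum_le_sum fun m _ => ?_) (by positivity)
  refine trace_mul_re_mono ?_ (hρ (c m)).1
  rw [sub_sub_sub_cancel_left]
  exact hβT m

variable {S : Type*} [Fintype S]

/-- The output state given `u`, for a joint distribution `q` of `(u, s)` and a channel `σ`. -/
noncomputable def condState (q : U → S → ℝ) (σ : U → S → Matrix d d ℂ) (u : U) :
    Matrix d d ℂ :=
  ∑ s, (q u s / ∑ s', q u s') • σ u s

omit [DecidableEq d] [Fintype U] in
theorem condState_posSemidef {q : U → S → ℝ} (hq : ∀ u s, 0 ≤ q u s)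
    {σ : U → S → Matrix d d ℂ} (hσ : ∀ u s, IsDensity (σ u s)) (u : U) :
    (condState q σ u).PosSemidef :=
  Matrix.posSemidef_sum _ fun s _ => (hσ u s).1.smul
    (div_nonneg (hq u s) (Finset.sum_nonneg fun _ _ => hq _ _))

omit [DecidableEq d] [Fintype U] in
theorem trace_mul_condState {q : U → S → ℝ} {σ : U → S → Matrix d d ℂ} (T : Matrix d d ℂ)
    (u : U) : (T * condState q σ u).trace.re
      = ∑ s, q u s / (∑ s', q u s') * (T * σ u s).trace.re := by
  simp only [condState, Matrix.mul_sum, Matrix.trace_sum, Matrix.mul_smul, Matrix.trace_smul,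
    Complex.re_sum, Complex.smul_re, smul_eq_mul]

omit [Fintype U] in
-- Only an inequality holds: where u has mass zero, the weights 0/0 are 0 and the conditional state
-- is the zero matrix.
theorem trace_condState_le {q : U → S → ℝ}
    {σ : U → S → Matrix d d ℂ} (hσ : ∀ u s, IsDensity (σ u s)) (u : U) :
    (condState q σ u).trace.re ≤ 1 := by
  have := trace_mul_condState (q := q) (σ := σ) 1 u
  simp only [Matrix.one_mul, (hσ _ _).trace_re, mul_one, ← Finset.sum_div] at this
  rw [this]
  exact div_self_le_one _

/-- Soft covering: the empirical mean of the likelihood ratios over `L` independent samples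
rarely falls below one. -/
theorem codebookMean_likelihood_deficit_le {I : Type*} [Fintype I] [DecidableEq I]
    {q : U → S → ℝ} (hq : ∀ u s, 0 ≤ q u s) (hq1 : ∑ u, ∑ s, q u s = 1) {t η : ℝ}
    (ht : 0 ≤ t) (hη : 0 < η) {L : ℕ} (hL : 0 < L) {e : Fin L → I}
    (he : Function.Injective e) :
    codebookMean (fun u => ∑ s, q u s) (fun c => ∑ s, (∑ u, q u s) *
        max 0 (1 - 1 / (L : ℝ) * ∑ l, likelihoodRatio q (c (e l)) s))
      ≤ ∑ u, ∑ s, (if t < likelihoodRatio q u s then q u s else 0) + η + t / (L * η) := by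
  have hL' : (0 : ℝ) < L := by positivity
  have hp0 : ∀ u, 0 ≤ ∑ s, q u s := fun u => Finset.sum_nonneg fun _ _ => hq _ _
  have hS0 : ∀ s, 0 ≤ ∑ u, q u s := fun s => Finset.sum_nonneg fun _ _ => hq _ _
  have hS1 : ∑ s, ∑ u, q u s = 1 := by rw [Finset.sum_comm]; exact hq1
  set h := truncRatio q t with hh
  set μ := fun s => ∑ u, (∑ s', q u s') * h u s with hμ
  have hpt : ∀ (s : S) (c : I → U),
      max 0 (1 - 1 / (L : ℝ) * ∑ l, likelihoodRatio q (c (e l)) s)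
        ≤ ((1 - μ s) + η)
          + 1 / η * (μ s - 1 / (L : ℝ) * ∑ l, h (c (e l)) s) ^ 2 := by
    intro s c
    -- Truncation only lowers the empirical mean, so the deficit may be estimated with the truncated
    -- ratios, whose variance is controlled.
    have h1 : 1 / (L : ℝ) * ∑ l, h (c (e l)) s
        ≤ 1 / (L : ℝ) * ∑ l, likelihoodRatio q (c (e l)) s :=
      mul_le_mul_of_nonneg_left (Finset.sum_le_sum fun l _ => truncRatio_le hq t _ s)
        (by positivity)
    have h2 : μ s ≤ 1 := sum_mul_truncRatio_le_one hq t s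
    set x := μ s - 1 / (L : ℝ) * ∑ l, h (c (e l)) s with hx
    -- A Chebyshev bound in expectation form: either x ≤ η or x ≤ x²/η.
    have h3 : x ≤ η + 1 / η * x ^ 2 := by
      have : 0 ≤ (x ^ 2 - x * η + η ^ 2) / η :=
        div_nonneg (by nlinarith [sq_nonneg (x - η), sq_nonneg x]) hη.le
      have e3 : (x ^ 2 - x * η + η ^ 2) / η = η + 1 / η * x ^ 2 - x := by field_simp; ring
      linarith
    have h4 : 0 ≤ 1 / η * x ^ 2 := by positivity
    exact max_le (by linarith) (by linarith)
  calc codebookMean (fun u => ∑ s, q u s) (fun c => ∑ s, (∑ u, q u s) *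
        max 0 (1 - 1 / (L : ℝ) * ∑ l, likelihoodRatio q (c (e l)) s))
      = ∑ s, (∑ u, q u s) * codebookMean (fun u => ∑ s, q u s) (fun c : I → U =>
          max 0 (1 - 1 / (L : ℝ) * ∑ l, likelihoodRatio q (c (e l)) s)) := by
        simp only [codebookMean_sum, codebookMean_const_mul]
    _ ≤ ∑ s, (∑ u, q u s) * ((1 - μ s) + η
          + 1 / η * (1 / (L : ℝ) * ∑ u, (∑ s', q u s') * h u s ^ 2)) := by
        refine Finset.sum_le_sum fun s _ => mul_le_mul_of_nonneg_left ?_ (hS0 s)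
        refine (codebookMean_mono hp0 (hpt s)).trans ?_
        rw [codebookMean_add, codebookMean_const hq1, codebookMean_const_mul]
        have := codebookMean_sq_le (p := fun u => ∑ s, q u s) hq1 hL he (fun u => h u s)
        have h5 := mul_le_mul_of_nonneg_left this (by positivity : 0 ≤ 1 / η)
        exact add_le_add le_rfl h5
    _ ≤ ∑ s, (∑ u, q u s) * ((1 - μ s) + η + t / (L * η) * μ s) := by
        refine Finset.sum_le_sum fun s _ => mul_le_mul_of_nonneg_left ?_ (hS0 s)
        have h6 : ∑ u, (∑ s', q u s') * h u s ^ 2 ≤ t * μ s := by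
          rw [hμ, Finset.mul_sum]
          refine Finset.sum_le_sum fun u _ => ?_
          have := mul_le_mul_of_nonneg_left (truncRatio_le_bound hq (t := t) u s) (hp0 u)
          calc _ ≤ _ := this
            _ = _ := by ring
        have h7 := mul_le_mul_of_nonneg_left h6 (by positivity : 0 ≤ 1 / η * (1 / (L : ℝ)))
        have e7 : 1 / η * (1 / (L : ℝ)) * (t * μ s) = t / (L * η) * μ s := by
          field_simp
        rw [e7, mul_assoc] at h7
        exact add_le_add le_rfl h7
    _ ≤ ∑ s, ((∑ u, q u s) * (1 - μ s) + (∑ u, q u s) * (η + t / (L * η))) := by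
        refine Finset.sum_le_sum fun s _ => ?_
        rw [← mul_add]
        refine mul_le_mul_of_nonneg_left ?_ (hS0 s)
        have h8 : t / (L * η) * μ s ≤ t / (L * η) :=
          mul_le_of_le_one_right (by positivity) (sum_mul_truncRatio_le_one hq t s)
        linarith
    _ = _ := by
        rw [Finset.sum_add_distrib, ← Finset.sum_mul, hS1, one_mul, ← add_assoc]
        congr 2
        rw [Finset.sum_comm (s := (Finset.univ : Finset U))]
        refine Finset.sum_congr rfl fun s _ => ?_
        rw [mul_sub, mul_one, hμ, Finset.mul_sum, ← Finset.sum_sub_distrib]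
        refine Finset.sum_congr rfl fun u _ => ?_
        rw [hh, marginals_mul_truncRatio hq, sub_sub_cancel]

/-- One-shot coding for a classical-quantum Gel'fand–Pinsker channel: a random codebook of
`M * L` sequences, a likelihood encoder and the square-root measurement. -/
theorem exists_gp_code {q : U → S → ℝ} (hq : ∀ u s, 0 ≤ q u s) (hq1 : ∑ u, ∑ s, q u s = 1)
    {σ : U → S → Matrix d d ℂ} (hσ : ∀ u s, IsDensity (σ u s))
    {P : U → Matrix d d ℂ} (hP : ∀ u, (P u).PosSemidef) (hP' : ∀ u, (1 - P u).PosSemidef)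
    {t η δ : ℝ} (ht : 0 ≤ t) (hη : 0 < η) (hδ : 0 < δ) {M L : ℕ} (hM : 0 < M) (hL : 0 < L) :
    ∃ (w : Fin M → S → U → ℝ) (β : Fin M → Matrix d d ℂ),
      (∀ m s, w m s ∈ stdSimplex ℝ U) ∧ (∀ m, (β m).PosSemidef) ∧ ∑ m, β m = 1 ∧
      1 / (M : ℝ) * ∑ m, ∑ s, (∑ u, q u s) * ∑ u, w m s u * ((1 - β m) * σ u s).trace.re
        ≤ (∑ u, ∑ s, (if t < likelihoodRatio q u s then q u s else 0) + η + t / (L * η))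
          + (2 * ∑ u, (∑ s, q u s) * ((1 - P u) * condState q σ u).trace.re
            + 4 * ((M * L : ℕ) * ∑ u, ∑ v, (∑ s, q u s) * (∑ s, q v s)
              * (P v * condState q σ u).trace.re) + 4 * δ) := by
  classical
  have hL' : (0 : ℝ) < L := by positivity
  have hM' : (0 : ℝ) < M := by positivity
  have hp0 : ∀ u, 0 ≤ ∑ s, q u s := fun u => Finset.sum_nonneg fun _ _ => hq _ _
  have hS0 : ∀ s, 0 ≤ ∑ u, q u s := fun s => Finset.sum_nonneg fun _ _ => hq _ _
  set K₁ := ∑ u, ∑ s, (if t < likelihoodRatio q u s then q u s else 0) + η + t / (L * η)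
  set K₂ := 2 * ∑ u, (∑ s, q u s) * ((1 - P u) * condState q σ u).trace.re
            + 4 * ((M * L : ℕ) * ∑ u, ∑ v, (∑ s, q u s) * (∑ s, q v s)
              * (P v * condState q σ u).trace.re) + 4 * δ with hK₂
  -- Covering and decoding errors are averaged together, so that one codebook is good for their sum.
  have hmean : codebookMean (fun u => ∑ s, q u s) (fun c : Fin M × Fin L → U =>
      1 / (M : ℝ) * ∑ m, ((∑ s, (∑ u, q u s) *
          max 0 (1 - 1 / (L : ℝ) * ∑ l, likelihoodRatio q (c (m, l)) s))
        + 1 / (L : ℝ) * ∑ l, ((1 - squareRootMeas (fun j => P (c j)) δ (m, l))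
            * condState q σ (c (m, l))).trace.re)) ≤ K₁ + K₂ := by
    rw [codebookMean_const_mul, codebookMean_sum]
    have hm : ∀ m : Fin M, codebookMean (fun u => ∑ s, q u s) (fun c : Fin M × Fin L → U =>
        (∑ s, (∑ u, q u s) *
          max 0 (1 - 1 / (L : ℝ) * ∑ l, likelihoodRatio q (c (m, l)) s))
        + 1 / (L : ℝ) * ∑ l, ((1 - squareRootMeas (fun j => P (c j)) δ (m, l))
            * condState q σ (c (m, l))).trace.re) ≤ K₁ + K₂ := by
      intro m
      rw [codebookMean_add]
      refine add_le_add (codebookMean_likelihood_deficit_le hq hq1 ht hη hL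
        (e := fun l => (m, l)) (fun _ _ h => (Prod.mk.inj h).2)) ?_
      rw [codebookMean_const_mul, codebookMean_sum]
      refine (mul_le_mul_of_nonneg_left (Finset.sum_le_sum fun l _ =>
        codebookMean_squareRootMeas_le hp0 hq1 hP hP' (condState_posSemidef hq hσ)
          (trace_condState_le hσ) hδ (m, l)) (by positivity)).trans ?_
      rw [Fintype.card_prod, Fintype.card_fin, Fintype.card_fin, ← hK₂, Finset.sum_const,
        Finset.card_univ, Fintype.card_fin, nsmul_eq_mul, ← mul_assoc,
        one_div_mul_cancel hL'.ne', one_mul]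
    refine (mul_le_mul_of_nonneg_left (Finset.sum_le_sum fun m _ => hm m)
      (by positivity)).trans ?_
    rw [Finset.sum_const, Finset.card_univ, Fintype.card_fin, nsmul_eq_mul, ← mul_assoc,
        one_div_mul_cancel hM'.ne', one_mul]
  obtain ⟨c, hc⟩ := exists_le_of_codebookMean_le hp0 hq1 hmean
  set Q := squareRootMeas (fun j => P (c j)) δ with hQ
  have hQ0 : ∀ i, (Q i).PosSemidef := squareRootMeas_posSemidef fun j => hP (c j)
  -- Only the message must be recovered, so the outcomes of a bin are merged.
  obtain ⟨β, hβ, hβ1, hβT⟩ := exists_measurement_of_sum_le hM (fun m => ∑ l, Q (m, l))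
    (fun m => Matrix.posSemidef_sum _ fun l _ => hQ0 (m, l)) (by
      have := one_sub_sum_squareRootMeas_posSemidef (fun j => hP (c j)) hδ
      rwa [← hQ, Fintype.sum_prod_type] at this)
  have hβle : ∀ m, (1 - β m).PosSemidef := fun m => by
    rw [← hβ1, ← Finset.add_sum_erase _ _ (Finset.mem_univ m), add_sub_cancel_left]
    exact Matrix.posSemidef_sum _ fun k _ => hβ k
  have hβQ : ∀ m l, (β m - Q (m, l)).PosSemidef := fun m l => by
    have h := (hβT m).add (Matrix.posSemidef_sum (Finset.univ.erase l)
      fun k _ => hQ0 (m, k))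
    have e : ∑ k, Q (m, k) = Q (m, l) + ∑ k ∈ Finset.univ.erase l, Q (m, k) :=
      (Finset.add_sum_erase _ _ (Finset.mem_univ l)).symm
    rw [e] at h
    convert h using 1
    abel
  set r := fun m s l => likelihoodRatio q (c (m, l)) s with hr
  have hr0 : ∀ m s l, 0 ≤ r m s l := fun m s l => likelihoodRatio_nonneg hq _ _
  have hsum : ∀ m s (f : U → ℝ),
      ∑ u, (∑ l, likelihood (r m s) l * if c (m, l) = u then 1 else 0) * f u
        = ∑ l, likelihood (r m s) l * f (c (m, l)) := by
    intro m s f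
    simp only [Finset.sum_mul]
    rw [Finset.sum_comm]
    refine Finset.sum_congr rfl fun l _ => ?_
    simp
  -- The encoder is the law of the codeword c (m, l) when l is drawn by likelihood; the sum collects
  -- repeated codewords.
  refine ⟨fun m s u => ∑ l, likelihood (r m s) l * if c (m, l) = u then 1 else 0, β,
    fun m s => ⟨fun u => Finset.sum_nonneg fun l _ =>
      mul_nonneg (likelihood_nonneg (hr0 m s) l) (by split_ifs <;> norm_num), ?_⟩,
    hβ, hβ1, le_trans ?_ hc⟩
  · have := hsum m s (fun _ => 1)
    simp only [mul_one] at this ⊢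
    rw [this, sum_likelihood hL]
  refine mul_le_mul_of_nonneg_left (Finset.sum_le_sum fun m _ => ?_) (by positivity)
  -- At the price of the deficit, the index l becomes uniform and s becomes distributed
  -- conditionally on the codeword. Summing over s then produces `condState`.
  have hstep : ∀ s, (∑ u, q u s) * ∑ l, likelihood (r m s) l
        * ((1 - β m) * σ (c (m, l)) s).trace.re
      ≤ (∑ u, q u s) * max 0 (1 - 1 / (L : ℝ) * ∑ l, r m s l)
        + 1 / (L : ℝ) * ∑ l, q (c (m, l)) s / (∑ s', q (c (m, l)) s')
          * ((1 - Q (m, l)) * σ (c (m, l)) s).trace.re := by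
    intro s
    have h1 := mul_le_mul_of_nonneg_left (sum_likelihood_mul_le hL (hr0 m s)
      (g := fun l => ((1 - β m) * σ (c (m, l)) s).trace.re)
      (fun l => trace_mul_re_nonneg (hβle m) (hσ _ s).1)
      (fun l => by
        rw [trace_one_sub_mul_re, (hσ _ _).trace_re]
        linarith [trace_mul_re_nonneg (hβ m) (hσ (c (m, l)) s).1])) (hS0 s)
    refine h1.trans ?_
    rw [mul_add, add_comm]
    refine add_le_add le_rfl ?_
    rw [mul_left_comm, Finset.mul_sum]
    refine mul_le_mul_of_nonneg_left (Finset.sum_le_sum fun l _ => ?_) (by positivity)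
    rw [← mul_assoc, hr, marginal_snd_mul_likelihoodRatio hq]
    refine mul_le_mul_of_nonneg_left ?_ (div_nonneg (hq _ _) (hp0 _))
    refine trace_mul_re_mono ?_ (hσ _ s).1
    rw [sub_sub_sub_cancel_left]
    exact hβQ m l
  simp only [hsum]
  refine (Finset.sum_le_sum fun s _ => hstep s).trans (le_of_eq ?_)
  rw [Finset.sum_add_distrib, ← Finset.mul_sum, Finset.sum_comm]
  simp only [trace_mul_condState, hr]

end OneShot

/-! ### Classical-quantum states and tests -/

section CQStates

variable {U d : Type*} [Fintype U] [DecidableEq U] [Fintype d] [DecidableEq d]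

omit [Fintype d] [DecidableEq d] in
theorem cqState_apply (p : U → ℝ) (ρ : U → Matrix d d ℂ) (i j : U × d) :
    cqState p ρ i j = if i.1 = j.1 then (p i.1 : ℂ) * ρ i.1 i.2 j.2 else 0 := by
  obtain ⟨i, b⟩ := i
  obtain ⟨j, b'⟩ := j
  simp only [cqState, ketbra, Matrix.sum_apply, Matrix.smul_apply, Matrix.kronecker_apply,
    Matrix.single_apply, Complex.real_smul]
  by_cases h : i = j
  · rw [if_pos h, Finset.sum_eq_single i]
    · simp [h]
    · intro u _ hu; simp [hu]
    · simp
  · rw [if_neg h]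
    refine Finset.sum_eq_zero fun u _ => ?_
    rw [if_neg (fun hu => h (hu.1.symm.trans hu.2))]
    simp

/-- The diagonal block of an operator on a bipartite system at a basis vector of the first
factor. -/
def diagBlock (T : Matrix (U × d) (U × d) ℂ) (u : U) : Matrix d d ℂ :=
  T.submatrix (Prod.mk u) (Prod.mk u)

omit [Fintype U] [DecidableEq U] [Fintype d] [DecidableEq d] in
theorem diagBlock_posSemidef {T : Matrix (U × d) (U × d) ℂ} (hT : T.PosSemidef) (u : U) :
    (diagBlock T u).PosSemidef :=
  hT.submatrix _

omit [Fintype U] [Fintype d] in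
theorem one_sub_diagBlock_posSemidef {T : Matrix (U × d) (U × d) ℂ} (hT : (1 - T).PosSemidef)
    (u : U) : (1 - diagBlock T u).PosSemidef := by
  have : 1 - diagBlock T u = diagBlock (1 - T) u := by
    ext i j
    simp [diagBlock, Matrix.one_apply]
  rw [this]
  exact diagBlock_posSemidef hT u

omit [DecidableEq d] in
-- A classical-quantum state is block diagonal, so an operator on the joint system acts on it only
-- through one operator per symbol u.
theorem trace_mul_cqState (T : Matrix (U × d) (U × d) ℂ) (p : U → ℝ) (ρ : U → Matrix d d ℂ) :
    (T * cqState p ρ).trace.re = ∑ u, p u * (diagBlock T u * ρ u).trace.re := by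
  have h : (T * cqState p ρ).trace = ∑ u, (p u : ℂ) * (diagBlock T u * ρ u).trace := by
    simp only [Matrix.trace, Matrix.diag_apply, Matrix.mul_apply, cqState_apply,
      Fintype.sum_prod_type, diagBlock, Matrix.submatrix_apply, Finset.mul_sum]
    refine Finset.sum_congr rfl fun u _ => Finset.sum_congr rfl fun i _ => ?_
    rw [Finset.sum_eq_single u]
    · refine Finset.sum_congr rfl fun j _ => ?_
      rw [if_pos rfl]; ring
    · intro v _ hv
      exact Finset.sum_eq_zero fun j _ => by rw [if_neg hv, mul_zero]
    · simp
  rw [h, Complex.re_sum]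
  exact Finset.sum_congr rfl fun u _ => Complex.re_ofReal_mul _ _

omit [Fintype d] [DecidableEq d] in
-- With all weights one, `cqState` is the block-diagonal operator with blocks T u; a family of tests
-- is thereby turned into a single joint test.
theorem diagBlock_cqState_one (T : U → Matrix d d ℂ) (u : U) :
    diagBlock (cqState (fun _ => 1) T) u = T u := by
  ext i j
  simp [diagBlock, cqState_apply]

omit [DecidableEq d] in
theorem cqState_posSemidef {p : U → ℝ} (hp : ∀ u, 0 ≤ p u) {ρ : U → Matrix d d ℂ}
    (hρ : ∀ u, (ρ u).PosSemidef) : (cqState p ρ).PosSemidef := by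
  refine Matrix.posSemidef_sum _ fun u _ => Matrix.PosSemidef.smul ?_ (hp u)
  refine Matrix.PosSemidef.kronecker ?_ (hρ u)
  have : ketbra u = Matrix.diagonal (Pi.single u (1 : ℂ)) := by
    rw [ketbra, Matrix.diagonal_single]
  rw [this]
  exact Matrix.PosSemidef.diagonal (Pi.single_nonneg.mpr zero_le_one)

omit [Fintype d] in
theorem one_sub_cqState_one (T : U → Matrix d d ℂ) :
    1 - cqState (fun _ => 1) T = cqState (fun _ => 1) (fun u => 1 - T u) := by
  ext ⟨u, i⟩ ⟨v, j⟩
  by_cases h : u = v <;> simp [cqState_apply, Matrix.one_apply, h]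

omit [DecidableEq d] in
-- The hypothesis asks for trace one only where p u ≠ 0, so that `condState`, which is zero on null
-- symbols, is covered.
theorem traceSnd_kronecker_traceFst_cqState {p : U → ℝ} {ρ : U → Matrix d d ℂ}
    (htr : ∀ u, (p u : ℂ) * (ρ u).trace = p u) :
    traceSnd (cqState p ρ) ⊗ₖ traceFst (cqState p ρ)
      = cqState p (fun _ => ∑ v, p v • ρ v) := by
  ext ⟨u, i⟩ ⟨v, j⟩
  simp only [Matrix.kronecker_apply, traceSnd, traceFst, Matrix.of_apply, cqState_apply,
    Matrix.sum_apply, Matrix.smul_apply, if_true, Complex.real_smul]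
  by_cases h : u = v
  · subst h
    simp only [if_true, ← Finset.mul_sum]
    have h := htr u
    simp only [Matrix.trace, Matrix.diag_apply] at h
    rw [h]
  · simp [h]

/-- The projection `{τ - c τ^U ⊗ τ^B ⪰ 0}` of a classical-quantum state. -/
noncomputable def cqProj (p : U → ℝ) (ρ : U → Matrix d d ℂ) (c : ℝ) :
    Matrix (U × d) (U × d) ℂ :=
  nonnegProj (cqState p ρ - c • (traceSnd (cqState p ρ) ⊗ₖ traceFst (cqState p ρ)))

variable {p : U → ℝ} {ρ : U → Matrix d d ℂ}

omit [DecidableEq U] [DecidableEq d] in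
theorem trace_mul_average (T : Matrix d d ℂ) :
    (T * ∑ v, p v • ρ v).trace.re = ∑ v, p v * (T * ρ v).trace.re := by
  simp only [Matrix.mul_sum, Matrix.trace_sum, Matrix.mul_smul, Matrix.trace_smul,
    Complex.re_sum, Complex.smul_re, smul_eq_mul]

omit [DecidableEq d] in
theorem isHermitian_cqState_sub (hp : ∀ u, 0 ≤ p u) (hρ : ∀ u, (ρ u).PosSemidef)
    (htr : ∀ u, (p u : ℂ) * (ρ u).trace = p u) (c : ℝ) :
    (cqState p ρ - c • (traceSnd (cqState p ρ) ⊗ₖ traceFst (cqState p ρ))).IsHermitian := by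
  rw [traceSnd_kronecker_traceFst_cqState htr]
  refine (cqState_posSemidef hp hρ).isHermitian.sub ?_
  have : (cqState p (fun _ : U => ∑ v, p v • ρ v)).PosSemidef :=
    cqState_posSemidef hp fun _ => Matrix.posSemidef_sum _ fun v _ => (hρ v).smul (hp v)
  exact this.isHermitian.smul (by exact IsSelfAdjoint.all c)

theorem trace_cqProj_mul_le_one (hp : ∀ u, 0 ≤ p u) (hp1 : ∑ u, p u = 1)
    (hρ : ∀ u, (ρ u).PosSemidef) (htr : ∀ u, (p u : ℂ) * (ρ u).trace = p u) (c : ℝ) :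
    (cqProj p ρ c * cqState p ρ).trace.re ≤ 1 := by
  refine (trace_mul_re_mono (one_sub_nonnegProj_posSemidef
    (isHermitian_cqState_sub hp hρ htr c)) (cqState_posSemidef hp hρ)).trans (le_of_eq ?_)
  rw [trace_mul_cqState, ← hp1]
  refine Finset.sum_congr rfl fun u _ => ?_
  have h1 : diagBlock (1 : Matrix (U × d) (U × d) ℂ) u = 1 := by
    ext i j
    simp [diagBlock, Matrix.one_apply]
  rw [h1, Matrix.one_mul, ← Complex.re_ofReal_mul, htr, Complex.ofReal_re]

theorem diagBlock_cqProj_posSemidef (c : ℝ) (u : U) :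
    (diagBlock (cqProj p ρ c) u).PosSemidef :=
  diagBlock_posSemidef (nonnegProj_posSemidef _) u

theorem one_sub_diagBlock_cqProj_posSemidef (hp : ∀ u, 0 ≤ p u) (hρ : ∀ u, (ρ u).PosSemidef)
    (htr : ∀ u, (p u : ℂ) * (ρ u).trace = p u) (c : ℝ) (u : U) :
    (1 - diagBlock (cqProj p ρ c) u).PosSemidef :=
  one_sub_diagBlock_posSemidef
    (one_sub_nonnegProj_posSemidef (isHermitian_cqState_sub hp hρ htr c)) u

/-- The probability that the test `{τ - c τ^U ⊗ τ^B ⪰ 0}` rejects the state `τ`. -/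
theorem sum_mul_trace_one_sub_diagBlock_cqProj (hp1 : ∑ u, p u = 1)
    (htr : ∀ u, (p u : ℂ) * (ρ u).trace = p u) (c : ℝ) :
    ∑ u, p u * ((1 - diagBlock (cqProj p ρ c) u) * ρ u).trace.re
      = 1 - (cqProj p ρ c * cqState p ρ).trace.re := by
  rw [trace_mul_cqState, ← hp1, ← Finset.sum_sub_distrib]
  refine Finset.sum_congr rfl fun u _ => ?_
  rw [trace_one_sub_mul_re, mul_sub, ← Complex.re_ofReal_mul _ (ρ u).trace, htr,
    Complex.ofReal_re]

/-- On the range of the projection τ dominates c times the product state, so c times the product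
acceptance is at most Tr[Πτ] ≤ 1. -/
theorem trace_cqProj_mul_product_le (hp : ∀ u, 0 ≤ p u) (hp1 : ∑ u, p u = 1)
    (hρ : ∀ u, (ρ u).PosSemidef) (htr : ∀ u, (p u : ℂ) * (ρ u).trace = p u) {c : ℝ}
    (hc : 0 < c) :
    ∑ u, ∑ v, p u * p v * (diagBlock (cqProj p ρ c) v * ρ u).trace.re ≤ c⁻¹ := by
  have h1 := (nonnegProj_mul_posSemidef (isHermitian_cqState_sub hp hρ htr c)).trace_nonneg
  have h2 := (Complex.le_def.mp h1).1
  have h3 := trace_cqProj_mul_le_one hp hp1 hρ htr c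
  rw [← cqProj, Matrix.mul_sub, Matrix.trace_sub, Complex.sub_re, Matrix.mul_smul,
    Matrix.trace_smul, Complex.smul_re, traceSnd_kronecker_traceFst_cqState htr,
    trace_mul_cqState (ρ := fun _ => _), Complex.zero_re, smul_eq_mul] at h2
  have e : ∑ u, ∑ v, p u * p v * (diagBlock (cqProj p ρ c) v * ρ u).trace.re
      = ∑ v, p v * (diagBlock (cqProj p ρ c) v * ∑ u, p u • ρ u).trace.re := by
    rw [Finset.sum_comm]
    refine Finset.sum_congr rfl fun v _ => ?_
    rw [trace_mul_average, Finset.mul_sum]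
    exact Finset.sum_congr rfl fun u _ => by ring
  rw [e, ← one_div, le_div_iff₀ hc]
  linarith

/-- Any test on the blocks bounds from below the probability that `{τ - c τ^U ⊗ τ^B ⪰ 0}`
accepts `τ`. -/
theorem le_trace_cqProj_mul (hp : ∀ u, 0 ≤ p u)
    (hρ : ∀ u, (ρ u).PosSemidef) (htr : ∀ u, (p u : ℂ) * (ρ u).trace = p u) {c : ℝ}
    (hc : 0 ≤ c) {T : U → Matrix d d ℂ} (hT : ∀ u, (T u).PosSemidef)
    (hT' : ∀ u, (1 - T u).PosSemidef) :
    ∑ u, p u * (T u * ρ u).trace.re - c * ∑ u, p u * (T u * ∑ v, p v • ρ v).trace.re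
      ≤ (cqProj p ρ c * cqState p ρ).trace.re := by
  have hσ : (cqState p (fun _ : U => ∑ v, p v • ρ v)).PosSemidef :=
    cqState_posSemidef hp fun _ => Matrix.posSemidef_sum _ fun v _ => (hρ v).smul (hp v)
  have h1 := trace_test_le (isHermitian_cqState_sub hp hρ htr c)
    (cqState_posSemidef (p := fun _ => 1) (fun _ => zero_le_one) hT) (by
      rw [one_sub_cqState_one]
      exact cqState_posSemidef (fun _ => zero_le_one) hT')
  rw [← cqProj, Matrix.mul_sub, Matrix.mul_sub, Matrix.trace_sub, Matrix.trace_sub,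
    Complex.sub_re, Complex.sub_re, Matrix.mul_smul, Matrix.mul_smul,
    Matrix.trace_smul, Matrix.trace_smul, Complex.smul_re, Complex.smul_re,
    traceSnd_kronecker_traceFst_cqState htr, trace_mul_cqState (p := p) (ρ := ρ),
    trace_mul_cqState (p := p) (ρ := fun _ => _)] at h1
  simp only [diagBlock_cqState_one, smul_eq_mul] at h1
  have h2 := mul_nonneg hc (trace_mul_re_nonneg (nonnegProj_posSemidef
    (cqState p ρ - c • (traceSnd (cqState p ρ) ⊗ₖ traceFst (cqState p ρ)))) hσ)
  rw [← cqProj] at h2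
  linarith

end CQStates

/-! ### The reduced state of an auxiliary input -/

section AuxStates

variable {X S B : Type*} [Fintype X] [DecidableEq X] [Fintype S] [DecidableEq S] [Fintype B]
  [DecidableEq B] {n : ℕ}

/-- The output state given `u` and `s`. -/
noncomputable def AuxInput.channel (a : AuxInput X S n)
    (ρ : (Fin n → X) → (Fin n → S) → Matrix (Fin n → B) (Fin n → B) ℂ) (u : Fin a.k)
    (s : Fin n → S) : Matrix (Fin n → B) (Fin n → B) ℂ :=
  ∑ x, a.pX u s x • ρ x s

omit [DecidableEq X] [Fintype S] [DecidableEq S] [DecidableEq B] in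
theorem AuxInput.trace_mul_channel (a : AuxInput X S n)
    (ρ : (Fin n → X) → (Fin n → S) → Matrix (Fin n → B) (Fin n → B) ℂ) (u : Fin a.k)
    (s : Fin n → S) (T : Matrix (Fin n → B) (Fin n → B) ℂ) :
    (T * a.channel ρ u s).trace.re = ∑ x, a.pX u s x * (T * ρ x s).trace.re := by
  simp only [channel, Matrix.mul_sum, Matrix.trace_sum, Matrix.mul_smul, Matrix.trace_smul,
    Complex.re_sum, Complex.smul_re, smul_eq_mul]

omit [DecidableEq X] [Fintype S] [DecidableEq S] [DecidableEq B] in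
theorem AuxInput.channel_isDensity (a : AuxInput X S n)
    {ρ : (Fin n → X) → (Fin n → S) → Matrix (Fin n → B) (Fin n → B) ℂ}
    (hρ : ∀ x s, IsDensity (ρ x s)) (u : Fin a.k) (s : Fin n → S) :
    IsDensity (a.channel ρ u s) := by
  refine ⟨Matrix.posSemidef_sum _ fun x _ => (hρ x s).1.smul ((a.pX_mem u s).1 x), ?_⟩
  simp only [channel, Matrix.trace_sum, Matrix.trace_smul, (hρ _ _).2]
  rw [← Finset.sum_smul, (a.pX_mem u s).2, one_smul]

omit [DecidableEq S] in
theorem mul_trace_condState {U d : Type*} [Fintype d] {q : U → S → ℝ} {σ : U → S → Matrix d d ℂ} (hσ : ∀ u s, IsDensity (σ u s)) (u : U) :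
    (((∑ s, q u s : ℝ)) : ℂ) * (condState q σ u).trace = ((∑ s, q u s : ℝ) : ℂ) := by
  simp only [condState, Matrix.trace_sum, Matrix.trace_smul, (hσ _ _).2]
  rw [← Finset.sum_smul, ← Finset.sum_div, Complex.real_smul, mul_one, ← Complex.ofReal_mul]
  by_cases h : ∑ s, q u s = 0
  · simp [h]
  · rw [div_self h, mul_one]

omit [DecidableEq S] in
theorem marginal_smul_condState {U d : Type*} {q : U → S → ℝ}
    (hq : ∀ u s, 0 ≤ q u s) (σ : U → S → Matrix d d ℂ) (u : U) :
    (∑ s, q u s) • condState q σ u = ∑ s, q u s • σ u s := by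
  rw [condState, Finset.smul_sum]
  refine Finset.sum_congr rfl fun s _ => ?_
  rw [smul_smul]
  by_cases h : ∑ s, q u s = 0
  · have : q u s = 0 :=
      (Finset.sum_eq_zero_iff_of_nonneg fun s _ => hq u s).mp h s (Finset.mem_univ s)
    simp [this]
  · rw [mul_div_cancel₀ _ h]

omit [Fintype B] [DecidableEq B] in
-- Tracing out s and x leaves the blocks Σ_s q(u,s) σ_{u,s}, which factor as marginal times
-- conditional state. The state-dependent problem thus falls under the classical-quantum bounds
-- above.
theorem AuxInput.reduceUB_theta (a : AuxInput X S n)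
    {ρ : (Fin n → X) → (Fin n → S) → Matrix (Fin n → B) (Fin n → B) ℂ}
    {pS : (Fin n → S) → ℝ} (hS : ∀ s, 0 ≤ pS s) :
    reduceUB (a.theta ρ pS) = cqState (fun u => ∑ s, a.jointUS pS u s)
      (condState (a.jointUS pS) (a.channel ρ)) := by
  have hq : ∀ u s, 0 ≤ a.jointUS pS u s := fun u s => mul_nonneg (hS s) ((a.pU_mem s).1 u)
  have hθ : ∀ s u x b s' u' x' b', a.theta ρ pS (s, u, x, b) (s', u', x', b')
      = if s = s' ∧ u = u' ∧ x = x' then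
        ((pS s * a.pU s u * a.pX u s x : ℝ) : ℂ) * ρ x s b b' else 0 := by
    intro s u x b s' u' x' b'
    simp only [theta, ketbra, Matrix.sum_apply, Matrix.smul_apply, Matrix.kronecker_apply,
      Matrix.single_apply, Complex.real_smul]
    rw [Finset.sum_eq_single s, Finset.sum_eq_single u, Finset.sum_eq_single x]
    · by_cases h1 : s = s' <;> by_cases h2 : u = u' <;> by_cases h3 : x = x' <;>
        simp [h1, h2, h3]
    · intro y _ hy; simp [hy]
    · simp
    · intro v _ hv; simp [hv]
    · simp
    · intro r _ hr; simp [hr]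
    · simp
  ext ⟨u, b⟩ ⟨u', b'⟩
  rw [cqState_apply]
  have h2 := congrFun (congrFun (marginal_smul_condState hq (a.channel ρ) u) b) b'
  simp only [Matrix.smul_apply, Complex.real_smul, Matrix.sum_apply] at h2
  dsimp only
  rw [h2]
  simp only [reduceUB, Matrix.of_apply, hθ, true_and, and_true]
  by_cases h : u = u'
  · simp only [h, if_true]
    refine Finset.sum_congr rfl fun s _ => ?_
    simp only [channel, jointUS, Matrix.sum_apply, Matrix.smul_apply, Complex.real_smul,
      Finset.mul_sum]
    refine Finset.sum_congr rfl fun x _ => ?_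
    push_cast
    ring
  · simp [h]

end AuxStates

/-! ### One-shot bounds for codes -/

section Codes

theorem IsDensity.mul_trace {d : Type*} [Fintype d] {ρ : Matrix d d ℂ} (h : IsDensity ρ)
    (x : ℝ) : (x : ℂ) * ρ.trace = x := by
  rw [h.2, mul_one]

theorem one_sub_posSemidef_of_sum_eq_one {d : Type*} [DecidableEq d] {M : ℕ}
    {β : Fin M → Matrix d d ℂ} (hβ : ∀ m, (β m).PosSemidef) (hβ1 : ∑ m, β m = 1) (m : Fin M) :
    (1 - β m).PosSemidef := by
  rw [← hβ1, ← Finset.add_sum_erase _ _ (Finset.mem_univ m), add_sub_cancel_left]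
  exact Matrix.posSemidef_sum _ fun k _ => hβ k

variable {X S B : Type*} [Fintype X] [DecidableEq X] [Fintype S] [DecidableEq S] [Fintype B]
  [DecidableEq B] {n : ℕ}

omit [DecidableEq S] in
omit [DecidableEq X] [Fintype S] in
theorem AuxInput.sum_jointUS (a : AuxInput X S n) (pS : (Fin n → S) → ℝ) (s : Fin n → S) :
    ∑ u, a.jointUS pS u s = pS s := by
  simp only [jointUS, ← Finset.mul_sum, (a.pU_mem s).2, mul_one]

omit [DecidableEq S] in
omit [DecidableEq X] [Fintype S] in
theorem AuxInput.jointUS_nonneg (a : AuxInput X S n) {pS : (Fin n → S) → ℝ}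
    (hS : ∀ s, 0 ≤ pS s) (u : Fin a.k) (s : Fin n → S) : 0 ≤ a.jointUS pS u s :=
  mul_nonneg (hS s) ((a.pU_mem s).1 u)

omit [DecidableEq X] [DecidableEq S] in
theorem AuxInput.sum_sum_jointUS (a : AuxInput X S n) {pS : (Fin n → S) → ℝ}
    (hS : ∑ s, pS s = 1) : ∑ u, ∑ s, a.jointUS pS u s = 1 := by
  rw [Finset.sum_comm]
  simp only [a.sum_jointUS, hS]

/-- The three terms are rejection of the true state, collision with the other codewords, and the
regularisation of the measurement. -/
theorem exists_cqCode_error_le {p : (Fin n → X) → ℝ} (hp : p ∈ stdSimplex ℝ (Fin n → X))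
    {ρ : (Fin n → X) → Matrix (Fin n → B) (Fin n → B) ℂ} (hρ : ∀ x, IsDensity (ρ x))
    {c δ : ℝ} (hc : 0 < c) (hδ : 0 < δ) {M : ℕ} (hM : 0 < M) :
    ∃ C : CQCode X B n M, C.error ρ
      ≤ 2 * (1 - (cqProj p ρ c * cqState p ρ).trace.re) + 4 * (M * c⁻¹) + 4 * δ := by
  have htr : ∀ u, (p u : ℂ) * (ρ u).trace = p u := fun u => (hρ u).mul_trace _
  obtain ⟨x, β, hβ, hβ1, hle⟩ := exists_cq_code hp.1 hp.2
    (diagBlock_cqProj_posSemidef (p := p) (ρ := ρ) c)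
    (one_sub_diagBlock_cqProj_posSemidef hp.1 (fun u => (hρ u).1) htr c) hρ hδ hM
  refine ⟨⟨fun m => Pi.single (x m) 1, fun m => single_mem_stdSimplex ℝ (x m), β, hβ, hβ1⟩, ?_⟩
  have e : ∀ m : Fin M, ∑ y, (Pi.single (x m) 1 : (Fin n → X) → ℝ) y
      * ((1 - β m) * ρ y).trace.re = ((1 - β m) * ρ (x m)).trace.re := fun m => by
    rw [Finset.sum_eq_single (x m)]
    · simp
    · intro y _ hy; simp [hy]
    · simp
  simp only [CQCode.error, e]
  refine hle.trans ?_
  rw [sum_mul_trace_one_sub_diagBlock_cqProj hp.2 htr]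
  have := mul_le_mul_of_nonneg_left (trace_cqProj_mul_product_le hp.1 hp.2 (fun u => (hρ u).1)
    htr hc) (Nat.cast_nonneg M : (0 : ℝ) ≤ M)
  linarith

omit [DecidableEq X] [DecidableEq S] in
theorem exists_gpCode_error_le (a : AuxInput X S n) {pS : (Fin n → S) → ℝ}
    (hS : pS ∈ stdSimplex ℝ (Fin n → S))
    {ρ : (Fin n → X) → (Fin n → S) → Matrix (Fin n → B) (Fin n → B) ℂ}
    (hρ : ∀ x s, IsDensity (ρ x s)) {c t η δ : ℝ} (hc : 0 < c) (ht : 0 ≤ t) (hη : 0 < η)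
    (hδ : 0 < δ) {M L : ℕ} (hM : 0 < M) (hL : 0 < L) :
    ∃ C : GPCode X S B n M, C.error ρ pS
      ≤ (∑ u, ∑ s, (if t < likelihoodRatio (a.jointUS pS) u s then a.jointUS pS u s else 0)
          + η + t / (L * η))
        + (2 * (1 - (cqProj (fun u => ∑ s, a.jointUS pS u s)
              (condState (a.jointUS pS) (a.channel ρ)) c
              * cqState (fun u => ∑ s, a.jointUS pS u s)
              (condState (a.jointUS pS) (a.channel ρ))).trace.re)
          + 4 * ((M * L : ℕ) * c⁻¹) + 4 * δ) := by
  have hq := a.jointUS_nonneg hS.1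
  have hq1 := a.sum_sum_jointUS hS.2
  have hp : ∀ u, 0 ≤ ∑ s, a.jointUS pS u s := fun u => Finset.sum_nonneg fun s _ => hq u s
  have hσ := fun u s => a.channel_isDensity hρ u s
  have hr := condState_posSemidef hq hσ
  have htr := mul_trace_condState (q := a.jointUS pS) hσ
  obtain ⟨w, β, hw, hβ, hβ1, hle⟩ := exists_gp_code hq hq1 hσ
    (diagBlock_cqProj_posSemidef (p := fun u => ∑ s, a.jointUS pS u s)
      (ρ := condState (a.jointUS pS) (a.channel ρ)) c)
    (one_sub_diagBlock_cqProj_posSemidef hp hr htr c) ht hη hδ hM hL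
  refine ⟨⟨fun m s x => ∑ u, w m s u * a.pX u s x, fun m s => ⟨fun x => Finset.sum_nonneg
    fun u _ => mul_nonneg ((hw m s).1 u) ((a.pX_mem u s).1 x), ?_⟩, β, hβ, hβ1⟩, ?_⟩
  · rw [Finset.sum_comm]
    simp only [← Finset.mul_sum, (a.pX_mem _ s).2, mul_one, (hw m s).2]
  · have e : ∀ m s, ∑ x, (∑ u, w m s u * a.pX u s x) * ((1 - β m) * ρ x s).trace.re
        = ∑ u, w m s u * ((1 - β m) * a.channel ρ u s).trace.re := by
      intro m s
      simp only [a.trace_mul_channel, Finset.sum_mul, Finset.mul_sum]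
      rw [Finset.sum_comm]
      simp only [mul_assoc]
    simp only [GPCode.error, e]
    simp only [a.sum_jointUS] at hle
    refine hle.trans ?_
    rw [sum_mul_trace_one_sub_diagBlock_cqProj hq1 htr]
    have := mul_le_mul_of_nonneg_left (trace_cqProj_mul_product_le hp hq1 hr htr hc)
      (Nat.cast_nonneg (M * L) : (0 : ℝ) ≤ ((M * L : ℕ) : ℝ))
    linarith

/-- The input law is that of the encoder output for a uniform message. The decoder, averaged over
the posterior of the message given the input, is a test accepting the joint state with probability 1
− error and the product state with probability 1/M. -/
theorem exists_input_of_cqCode {M : ℕ} (hM : 0 < M) (C : CQCode X B n M)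
    {ρ : (Fin n → X) → Matrix (Fin n → B) (Fin n → B) ℂ} (hρ : ∀ x, IsDensity (ρ x)) :
    ∃ p : stdSimplex ℝ (Fin n → X), ∀ c : ℝ, 0 ≤ c →
      1 - C.error ρ - c / M ≤ (cqProj p ρ c * cqState p ρ).trace.re := by
  have hM' : (0 : ℝ) < M := by positivity
  set q : (Fin n → X) → Fin M → ℝ := fun x m => 1 / (M : ℝ) * C.enc m x with hqdef
  have hq : ∀ x m, 0 ≤ q x m := fun x m => mul_nonneg (by positivity) ((C.enc_mem m).1 x)
  have hqm : ∀ m, ∑ x, q x m = 1 / (M : ℝ) := fun m => by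
    simp only [hqdef, ← Finset.mul_sum, (C.enc_mem m).2, mul_one]
  set p : (Fin n → X) → ℝ := fun x => ∑ m, q x m with hpdef
  have hp0 : ∀ x, 0 ≤ p x := fun x => Finset.sum_nonneg fun m _ => hq x m
  have hp1 : ∑ x, p x = 1 := by
    rw [hpdef, Finset.sum_comm]
    simp only [hqm, Finset.sum_const, Finset.card_univ, Fintype.card_fin, nsmul_eq_mul]
    field_simp
  refine ⟨⟨p, hp0, hp1⟩, fun c hc => ?_⟩
  have hpq : ∀ (x : Fin n → X) (f : Fin M → ℝ),
      p x * ∑ m, q x m / p x * f m = ∑ m, q x m * f m := by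
    intro x f
    rw [Finset.mul_sum]
    refine Finset.sum_congr rfl fun m _ => ?_
    by_cases h : p x = 0
    · have : q x m = 0 :=
        (Finset.sum_eq_zero_iff_of_nonneg fun m _ => hq x m).mp h m (Finset.mem_univ m)
      simp [this]
    · field_simp
  -- q x m / p x is the posterior of m given x, needed because a randomized encoder need not let x
  -- determine m. On null inputs T x is zero.
  set T := fun x => ∑ m, (q x m / p x) • C.dec m with hT
  have hTtr : ∀ x ω, p x * (T x * ω).trace.re = ∑ m, q x m * (C.dec m * ω).trace.re := by
    intro x ω
    rw [← hpq x]
    simp only [hT, Matrix.sum_mul, Matrix.trace_sum, Matrix.smul_mul, Matrix.trace_smul,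
      Complex.re_sum, Complex.smul_re, smul_eq_mul]
  have hco : ∀ x m, 0 ≤ q x m / p x := fun x m => div_nonneg (hq x m) (hp0 x)
  have hT0 : ∀ x, (T x).PosSemidef := fun x =>
    Matrix.posSemidef_sum _ fun m _ => (C.dec_pos m).smul (hco x m)
  have hT1 : ∀ x, (1 - T x).PosSemidef := by
    intro x
    have hle : ∀ m, 0 ≤ 1 - q x m / p x := fun m => by
      have : q x m ≤ p x :=
        Finset.single_le_sum (f := fun m => q x m) (fun m _ => hq x m) (Finset.mem_univ m)
      linarith [div_le_one_of_le₀ this (hp0 x)]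
    have e : 1 - T x = ∑ m, (1 - q x m / p x) • C.dec m := by
      simp only [sub_smul, one_smul, Finset.sum_sub_distrib, C.dec_sum, hT]
    rw [e]
    exact Matrix.posSemidef_sum _ fun m _ => (C.dec_pos m).smul (hle m)
  have h := le_trace_cqProj_mul hp0 (fun x => (hρ x).1) (fun x => (hρ x).mul_trace (p x)) hc
    hT0 hT1
  refine le_trans (le_of_eq ?_) h
  have e1 : ∑ x, p x * (T x * ρ x).trace.re = 1 - C.error ρ := by
    simp only [hTtr, CQCode.error, trace_one_sub_mul_re, (hρ _).trace_re, mul_sub, mul_one,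
      Finset.sum_sub_distrib, (C.enc_mem _).2]
    simp only [Finset.sum_const, Finset.card_univ, Fintype.card_fin, nsmul_eq_mul, mul_one,
      one_div_mul_cancel hM'.ne', sub_sub_cancel, hqdef, Finset.mul_sum]
    rw [Finset.sum_comm]
    simp only [mul_assoc]
  have e2 : ∑ x, p x * (T x * ∑ v, p v • ρ v).trace.re = 1 / M := by
    simp only [hTtr]
    rw [Finset.sum_comm]
    simp only [← Finset.sum_mul, hqm]
    rw [← Finset.mul_sum, ← Complex.re_sum, ← Matrix.trace_sum, ← Matrix.sum_mul, C.dec_sum,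
      trace_mul_average]
    simp only [Matrix.one_mul, (hρ _).trace_re, mul_one, hp1]
  rw [e1, e2, mul_one_div]

omit [DecidableEq X] [DecidableEq S] in
-- The auxiliary variable is the message itself, uniform and independent of the state, with the
-- encoder as the law of x given (u, s). The decoding POVM is then directly a family of tests
-- indexed by u.
theorem exists_auxInput_of_gpCode {M : ℕ} (hM : 0 < M) (C : GPCode X S B n M)
    {pS : (Fin n → S) → ℝ} (hS : pS ∈ stdSimplex ℝ (Fin n → S))
    {ρ : (Fin n → X) → (Fin n → S) → Matrix (Fin n → B) (Fin n → B) ℂ}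
    (hρ : ∀ x s, IsDensity (ρ x s)) :
    ∃ a : AuxInput X S n, (∀ u s, a.jointUS pS u s = pS s / a.k) ∧ ∀ c : ℝ, 0 ≤ c →
      1 - C.error ρ pS - c / M ≤ (cqProj (fun u => ∑ s, a.jointUS pS u s)
              (condState (a.jointUS pS) (a.channel ρ)) c
              * cqState (fun u => ∑ s, a.jointUS pS u s)
              (condState (a.jointUS pS) (a.channel ρ))).trace.re := by
  have hM' : (0 : ℝ) < M := by positivity
  set a : AuxInput X S n := ⟨M, fun _ _ => 1 / (M : ℝ), fun _ => ⟨fun _ => by positivity, by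
    simp [hM'.ne']⟩, C.enc, C.enc_mem⟩ with ha
  have hj : ∀ u s, a.jointUS pS u s = pS s / a.k := fun u s => mul_one_div _ _
  refine ⟨a, hj, fun c hc => ?_⟩
  have hq := a.jointUS_nonneg hS.1
  have hp : ∀ u, 0 ≤ ∑ s, a.jointUS pS u s := fun u => Finset.sum_nonneg fun s _ => hq u s
  have hσ := fun u s => a.channel_isDensity hρ u s
  have hr := condState_posSemidef hq hσ
  have htr := mul_trace_condState (q := a.jointUS pS) hσ
  have h := le_trace_cqProj_mul hp hr htr hc C.dec_pos
    (one_sub_posSemidef_of_sum_eq_one C.dec_pos C.dec_sum)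
  refine le_trans (le_of_eq ?_) h
  have hpu : ∀ u : Fin M, ∑ s, a.jointUS pS u s = 1 / M := fun u => by
    simp only [hj, ← Finset.sum_div, hS.2, ha]
  have e1 : ∑ u : Fin M, (∑ s, a.jointUS pS u s)
      * (C.dec u * condState (a.jointUS pS) (a.channel ρ) u).trace.re = 1 - C.error ρ pS := by
    have e3 : ∀ u : Fin M, (∑ s, a.jointUS pS u s)
        * (C.dec u * condState (a.jointUS pS) (a.channel ρ) u).trace.re
        = 1 / (M : ℝ) * (1 - ∑ s, pS s * ∑ x, C.enc u s x * ((1 - C.dec u) * ρ x s).trace.re) := by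
      intro u
      rw [← smul_eq_mul, ← Complex.smul_re, ← Matrix.trace_smul, ← Matrix.mul_smul,
        marginal_smul_condState hq]
      simp only [Matrix.mul_sum, Matrix.trace_sum, Matrix.mul_smul, Matrix.trace_smul,
        Complex.re_sum, Complex.smul_re, smul_eq_mul, a.trace_mul_channel, trace_one_sub_mul_re,
        (hρ _ _).trace_re, mul_sub, mul_one, Finset.sum_sub_distrib, (C.enc_mem _ _).2, hS.2]
      rw [sub_sub_cancel]
      rw [Finset.mul_sum]
      refine Finset.sum_congr rfl fun s _ => ?_
      have hju : a.jointUS pS u s = 1 / (M : ℝ) * pS s := mul_comm _ _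
      rw [hju, mul_assoc]
    have e4 := Finset.sum_congr (rfl : (Finset.univ : Finset (Fin M)) = _) fun u _ => e3 u
    rw [e4, ← Finset.mul_sum, Finset.sum_sub_distrib, mul_sub, GPCode.error]
    simp [hM'.ne']
  have e2 : ∑ u : Fin M, (∑ s, a.jointUS pS u s) * (C.dec u * ∑ v, (∑ s, a.jointUS pS v s)
      • condState (a.jointUS pS) (a.channel ρ) v).trace.re = 1 / M := by
    have e6 : ∀ ω, ∑ u : Fin M, (∑ s, a.jointUS pS u s) * (C.dec u * ω).trace.re
        = 1 / (M : ℝ) * (1 * ω).trace.re := by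
      intro ω
      simp only [hpu]
      rw [← Finset.mul_sum, ← Complex.re_sum, ← Matrix.trace_sum, ← Matrix.sum_mul, C.dec_sum]
    rw [e6, trace_mul_average]
    simp only [Matrix.one_mul]
    have e5 : ∀ v, (∑ s, a.jointUS pS v s)
        * (condState (a.jointUS pS) (a.channel ρ) v).trace.re = ∑ s, a.jointUS pS v s :=
      fun v => by rw [← Complex.re_ofReal_mul, htr, Complex.ofReal_re]
    exact (congrArg (1 / (M : ℝ) * ·) ((Finset.sum_congr rfl fun v _ => e5 v).trans
      (a.sum_sum_jointUS hS.2))).trans (mul_one _)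
  refine Eq.trans ?_ (congrArg₂ (fun x y => x - c * y) e1 e2).symm
  simp only [mul_one_div]

end Codes

/-! ### Asymptotics -/

section Asymptotics

/-- If a property holds eventually for every fixed error `ε > 0`, then it holds eventually along
some vanishing sequence of errors. -/
theorem exists_tendsto_zero_of_forall_eventually {G : ℕ → ℝ → Prop}
    (h : ∀ ε : ℝ, 0 < ε → ∀ᶠ n in atTop, G n ε) :
    ∃ e : ℕ → ℝ, Tendsto e atTop (𝓝 0) ∧ ∀ᶠ n in atTop, G n (e n) := by
  classical
  set Q : ℕ → ℕ → Prop := fun n k => G n (1 / ((k : ℝ) + 1))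
  have hQ : ∀ k, ∀ᶠ n in atTop, Q n k := fun k => h _ (by positivity)
  -- The finest level 1/(k+1), k ≤ n, already valid at n; each level is eventually valid, so k n
  -- tends to infinity.
  set k : ℕ → ℕ := fun n => Nat.findGreatest (Q n) n
  refine ⟨fun n => 1 / ((k n : ℝ) + 1), ?_, ?_⟩
  · have hk : Tendsto k atTop atTop := tendsto_atTop.mpr fun K => by
      filter_upwards [hQ K, eventually_ge_atTop K] with n h1 h2
      exact Nat.le_findGreatest h2 h1
    exact (tendsto_one_div_add_atTop_nhds_zero_nat (𝕜 := ℝ)).comp hk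
  -- `Nat.findGreatest` defaults to 0 when no level is valid, hence the restriction to n where level
  -- 0 holds.
  · filter_upwards [hQ 0] with n hn
    exact Nat.findGreatest_spec (P := Q n) (Nat.zero_le n) hn

theorem tendsto_two_rpow_neg {γ : ℝ} (hγ : 0 < γ) :
    Tendsto (fun n : ℕ => (2 : ℝ) ^ ((n : ℝ) * (-γ))) atTop (𝓝 0) := by
  have h : ∀ n : ℕ, (2 : ℝ) ^ ((n : ℝ) * (-γ)) = ((2 : ℝ) ^ (-γ)) ^ n := fun n => by
    rw [mul_comm, Real.rpow_mul_natCast (by norm_num)]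
  simp only [h]
  exact tendsto_pow_atTop_nhds_zero_of_lt_one (by positivity)
    (Real.rpow_lt_one_of_one_lt_of_neg (by norm_num) (by linarith))

theorem two_rpow_le_of_le_rate {n M : ℕ} (hn : 0 < n) (hM : 0 < M) {R : ℝ}
    (h : R ≤ 1 / (n : ℝ) * Real.logb 2 M) : (2 : ℝ) ^ ((n : ℝ) * R) ≤ M := by
  have hn' : (0 : ℝ) < n := by exact_mod_cast hn
  rw [← Real.le_logb_iff_rpow_le (by norm_num) (by exact_mod_cast hM)]
  rw [one_div, ← div_eq_inv_mul, le_div_iff₀ hn'] at h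
  linarith

theorem le_rate_of_two_rpow_le {n M : ℕ} (hn : 0 < n) {R : ℝ}
    (h : (2 : ℝ) ^ ((n : ℝ) * R) ≤ M) : R ≤ 1 / (n : ℝ) * Real.logb 2 M := by
  have hn' : (0 : ℝ) < n := by exact_mod_cast hn
  have hM : (0 : ℝ) < M := lt_of_lt_of_le (by positivity) h
  rw [← Real.le_logb_iff_rpow_le (by norm_num) hM] at h
  rw [one_div, ← div_eq_inv_mul, le_div_iff₀ hn']
  linarith

theorem ceil_two_rpow_pos (x : ℝ) : 0 < ⌈(2 : ℝ) ^ x⌉₊ :=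
  Nat.ceil_pos.mpr (by positivity)

/-- Doubling absorbs the ceiling only for numbers at least one. Negative rates are therefore treated
apart, and the binning rate is shown nonnegative. -/
theorem ceil_two_rpow_le {x : ℝ} (hx : 0 ≤ x) : (⌈(2 : ℝ) ^ x⌉₊ : ℝ) ≤ 2 * (2 : ℝ) ^ x := by
  have h1 := (Nat.ceil_lt_add_one (by positivity : (0 : ℝ) ≤ (2 : ℝ) ^ x)).le
  have h2 : (1 : ℝ) ≤ (2 : ℝ) ^ x := Real.one_le_rpow (by norm_num) hx
  linarith

/-- The number of messages `⌈2^{nR'}⌉` has rate larger than `R` if `R < R'`. -/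
theorem lt_liminf_rate {R R' : ℝ} (h : R < R') :
    (R : EReal) < liminf (fun n : ℕ =>
      ((1 / (n : ℝ) * Real.logb 2 (⌈(2 : ℝ) ^ ((n : ℝ) * R')⌉₊ : ℕ) : ℝ) : EReal)) atTop := by
  refine lt_of_lt_of_le (EReal.coe_lt_coe_iff.mpr h) (le_liminf_of_le (by isBoundedDefault) ?_)
  filter_upwards [eventually_gt_atTop 0] with n hn
  exact EReal.coe_le_coe_iff.mpr (le_rate_of_two_rpow_le hn (Nat.le_ceil _))

theorem limsup_coe_lt {e : ℕ → ℝ} (he : Tendsto e atTop (𝓝 0)) {ε : ℝ} (hε : 0 < ε) :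
    limsup (fun n : ℕ => (e n : EReal)) atTop < (ε : EReal) := by
  have := (continuous_coe_real_ereal.tendsto 0).comp he
  rw [show (fun n => (e n : EReal)) = Real.toEReal ∘ e from rfl, this.limsup_eq]
  exact EReal.coe_lt_coe_iff.mpr hε

/-- Since M ≥ 2^{nR}, the threshold 2^{n(R−γ)} leaves a converse loss of at most 2^{−nγ}. -/
theorem tendsto_accept {z e : ℕ → ℝ} {M : ℕ → ℕ} {R γ : ℝ} (hγ : 0 < γ) (hz1 : ∀ n, z n ≤ 1)
    (he : Tendsto e atTop (𝓝 0))
    (hz : ∀ᶠ n : ℕ in atTop, 0 < M n ∧ R < 1 / (n : ℝ) * Real.logb 2 (M n) ∧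
      1 - e n - (2 : ℝ) ^ ((n : ℝ) * (R - γ)) / M n ≤ z n) :
    Tendsto z atTop (𝓝 1) := by
  have hlow : Tendsto (fun n : ℕ => 1 - e n - (2 : ℝ) ^ ((n : ℝ) * (-γ))) atTop (𝓝 1) := by
    have := (tendsto_const_nhds (x := (1 : ℝ))).sub he |>.sub (tendsto_two_rpow_neg hγ)
    simpa using this
  refine tendsto_of_tendsto_of_tendsto_of_le_of_le' hlow tendsto_const_nhds ?_
    (Eventually.of_forall hz1)
  filter_upwards [hz, eventually_gt_atTop 0] with n ⟨hM, hR, h⟩ hn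
  refine le_trans ?_ h
  have hle := two_rpow_le_of_le_rate hn hM hR.le
  have hM' : (0 : ℝ) < M n := by exact_mod_cast hM
  have : (2 : ℝ) ^ ((n : ℝ) * (R - γ)) / M n ≤ (2 : ℝ) ^ ((n : ℝ) * (-γ)) := by
    rw [div_le_iff₀ hM']
    calc (2 : ℝ) ^ ((n : ℝ) * (R - γ)) = (2 : ℝ) ^ ((n : ℝ) * (-γ)) * (2 : ℝ) ^ ((n : ℝ) * R) := by
          rw [← Real.rpow_add (by norm_num)]; ring_nf
      _ ≤ _ := mul_le_mul_of_nonneg_left hle (by positivity)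
  linarith

theorem two_rpow_product_le {n : ℕ} {x y z : ℝ} {K C : ℝ} (hK : K ≤ C * (2 : ℝ) ^ ((n : ℝ) * x))
    (h : x - y = z) : K * ((2 : ℝ) ^ ((n : ℝ) * y))⁻¹ ≤ C * (2 : ℝ) ^ ((n : ℝ) * z) := by
  rw [← div_eq_mul_inv, div_le_iff₀ (by positivity), mul_assoc, ← Real.rpow_add (by norm_num)]
  have : (n : ℝ) * z + n * y = n * x := by rw [← h]; ring
  rwa [this]

end Asymptotics

section Capacity

variable {X S B : Type*} [Fintype X] [DecidableEq X] [Fintype S] [DecidableEq S] [Fintype B]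
  [DecidableEq B]

/-! ### Capacity of classical-quantum channels -/

theorem exists_le_spectralInfMI_of_CQAchievable [Nonempty X]
    {ρ : ∀ n, (Fin n → X) → Matrix (Fin n → B) (Fin n → B) ℂ}
    (hρ : ∀ n x, IsDensity (ρ n x)) {R : ℝ} (hR : CQAchievable ρ R) :
    ∃ p : ∀ n : ℕ, stdSimplex ℝ (Fin n → X),
      (R : EReal) ≤ spectralInfMI (fun n => cqState (p n : (Fin n → X) → ℝ) (ρ n)) := by
  classical
  obtain ⟨e, he, hG⟩ := exists_tendsto_zero_of_forall_eventually
    (G := fun n ε => ∃ (M : ℕ) (C : CQCode X B n M), 0 < M ∧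
      R < 1 / (n : ℝ) * Real.logb 2 M ∧ C.error (ρ n) ≤ ε) (fun ε hε => by
    obtain ⟨M, e, c, hM, herr, hrate, hlim⟩ := hR ε hε
    filter_upwards [eventually_lt_of_lt_liminf hrate, eventually_lt_of_limsup_lt hlim]
      with n h1 h2
    exact ⟨M n, c n, hM n, EReal.coe_lt_coe_iff.mp h1,
      (herr n).trans (EReal.coe_lt_coe_iff.mp h2).le⟩)
  have hex : ∀ n, ∃ (p : stdSimplex ℝ (Fin n → X)) (M : ℕ),
      (∃ (M : ℕ) (C : CQCode X B n M), 0 < M ∧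
        R < 1 / (n : ℝ) * Real.logb 2 M ∧ C.error (ρ n) ≤ e n) →
      0 < M ∧ R < 1 / (n : ℝ) * Real.logb 2 M ∧ ∀ c : ℝ, 0 ≤ c →
        1 - e n - c / M ≤ (cqProj (p : (Fin n → X) → ℝ) (ρ n) c * cqState p (ρ n)).trace.re := by
    intro n
    by_cases h : ∃ (M : ℕ) (C : CQCode X B n M), 0 < M ∧
        R < 1 / (n : ℝ) * Real.logb 2 M ∧ C.error (ρ n) ≤ e n
    · obtain ⟨M, C, hM, hr, herr⟩ := h
      obtain ⟨p, hp⟩ := exists_input_of_cqCode hM C (hρ n)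
      exact ⟨p, M, fun _ => ⟨hM, hr, fun c hc => le_trans (by linarith) (hp c hc)⟩⟩
    -- An arbitrary input where no good code exists; this happens for finitely many n only.
    · exact ⟨⟨_, single_mem_stdSimplex ℝ (Classical.arbitrary (Fin n → X))⟩, 0,
        fun h' => absurd h' h⟩
  choose p M hpM using hex
  refine ⟨p, le_sSup ⟨R, fun γ hγ => ?_, rfl⟩⟩
  refine tendsto_accept (e := e) (M := M) (R := R) hγ
    (fun n => trace_cqProj_mul_le_one (p n).2.1 (p n).2.2 (fun x => (hρ n x).1)
      (fun x => (hρ n x).mul_trace _) _) he ?_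
  filter_upwards [hG] with n hn
  obtain ⟨h1, h2, h3⟩ := hpM n hn
  exact ⟨h1, h2, h3 _ (by positivity)⟩

/-- A single message is decoded without error at rate zero. -/
theorem CQAchievable_of_neg [Nonempty X]
    (ρ : ∀ n, (Fin n → X) → Matrix (Fin n → B) (Fin n → B) ℂ) {R : ℝ} (hR : R < 0) :
    CQAchievable ρ R := by
  intro ε hε
  refine ⟨fun _ => 1, fun _ => 0, fun n => ⟨fun _ => Pi.single (Classical.arbitrary _) 1,
    fun _ => single_mem_stdSimplex ℝ _, fun _ => 1, fun _ => Matrix.PosSemidef.one, by simp⟩,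
    fun _ => one_pos, fun n => by simp [CQCode.error], ?_, limsup_coe_lt tendsto_const_nhds hε⟩
  simpa using hR

theorem CQAchievable_of_lt_spectralInfMI [Nonempty X]
    {ρ : ∀ n, (Fin n → X) → Matrix (Fin n → B) (Fin n → B) ℂ}
    (hρ : ∀ n x, IsDensity (ρ n x)) (p : ∀ n : ℕ, stdSimplex ℝ (Fin n → X)) {R : ℝ}
    (hR : (R : EReal) < spectralInfMI (fun n => cqState (p n : (Fin n → X) → ℝ) (ρ n))) :
    CQAchievable ρ R := by
  rcases lt_or_ge R 0 with h0 | h0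
  · exact CQAchievable_of_neg ρ h0
  obtain ⟨_, ⟨a, ha, rfl⟩, hRa⟩ := lt_sSup_iff.mp hR
  have hRa := EReal.coe_lt_coe_iff.mp hRa
  -- The gap a − R is cut in three: excess rate, slack in the threshold, and the decay exponent of
  -- the collision term.
  obtain ⟨γ, hγ, hγ'⟩ : ∃ γ : ℝ, 0 < γ ∧ (R + γ) - (a - γ) = -γ :=
    ⟨(a - R) / 3, by linarith, by ring⟩
  have hz := ha γ hγ
  have hcode := fun n : ℕ => exists_cqCode_error_le (p n).2 (hρ n)
    (c := (2 : ℝ) ^ ((n : ℝ) * (a - γ))) (by positivity)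
    (δ := 1 / ((n : ℝ) + 1)) (by positivity) (ceil_two_rpow_pos ((n : ℝ) * (R + γ)))
  choose C hC using hcode
  have hlim : Tendsto (fun n : ℕ => 2 * (1 - (cqProj (p n : (Fin n → X) → ℝ) (ρ n)
      ((2 : ℝ) ^ ((n : ℝ) * (a - γ))) * cqState (p n : (Fin n → X) → ℝ) (ρ n)).trace.re)
      + 4 * (2 * (2 : ℝ) ^ ((n : ℝ) * (-γ))) + 4 * (1 / ((n : ℝ) + 1))) atTop (𝓝 0) := by
    have h1 := (tendsto_const_nhds (x := (1 : ℝ))).sub hz |>.const_mul 2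
    have h2 := ((tendsto_two_rpow_neg hγ).const_mul 2).const_mul 4
    have h3 := (tendsto_one_div_add_atTop_nhds_zero_nat (𝕜 := ℝ)).const_mul 4
    have h := (h1.add h2).add h3
    simp only [sub_self, mul_zero, add_zero] at h
    exact h
  intro ε hε
  refine ⟨_, _, C, fun n => ceil_two_rpow_pos _, fun n => (hC n).trans ?_,
    lt_liminf_rate (by linarith), limsup_coe_lt hlim hε⟩
  have := two_rpow_product_le (ceil_two_rpow_le
    (by positivity : 0 ≤ (n : ℝ) * (R + γ))) hγ'
  exact add_le_add (add_le_add le_rfl (mul_le_mul_of_nonneg_left this (by norm_num))) le_rfl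

theorem cqCapacity_eq [Nonempty X]
    {ρ : ∀ n, (Fin n → X) → Matrix (Fin n → B) (Fin n → B) ℂ}
    (hρ : ∀ n x, IsDensity (ρ n x)) :
    cqCapacity ρ = ⨆ p : ∀ n : ℕ, stdSimplex ℝ (Fin n → X),
      spectralInfMI (fun n => cqState (p n : (Fin n → X) → ℝ) (ρ n)) := by
  refine le_antisymm (sSup_le ?_) (iSup_le fun p => ?_)
  · rintro _ ⟨R, hR, rfl⟩
    obtain ⟨p, hp⟩ := exists_le_spectralInfMI_of_CQAchievable hρ hR
    exact hp.trans (le_iSup (fun p : ∀ n : ℕ, stdSimplex ℝ (Fin n → X) =>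
      spectralInfMI (fun n => cqState (p n : (Fin n → X) → ℝ) (ρ n))) p)
  · by_contra! h
    obtain ⟨R, h1, h2⟩ := EReal.lt_iff_exists_real_btwn.mp h
    have h3 : (R : EReal) ≤ cqCapacity ρ :=
      le_sSup ⟨R, CQAchievable_of_lt_spectralInfMI hρ p h2, rfl⟩
    exact absurd h3 (not_le.mpr h1)

/-! ### Capacity of classical-quantum Gel'fand–Pinsker channels -/

omit [DecidableEq S] in
theorem GPAchievable_of_neg [Nonempty X]
    (ρ : ∀ n, (Fin n → X) → (Fin n → S) → Matrix (Fin n → B) (Fin n → B) ℂ)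
    (pS : ∀ n, (Fin n → S) → ℝ) {R : ℝ} (hR : R < 0) : GPAchievable ρ pS R := by
  intro ε hε
  refine ⟨fun _ => 1, fun _ => 0, fun n => ⟨fun _ _ => Pi.single (Classical.arbitrary _) 1,
    fun _ _ => single_mem_stdSimplex ℝ _, fun _ => 1, fun _ => Matrix.PosSemidef.one, by simp⟩,
    fun _ => one_pos, fun n => by simp [GPCode.error], ?_, limsup_coe_lt tendsto_const_nhds hε⟩
  simpa using hR

/-- Taking logarithms is legitimate where q > 0; elsewhere the summand is zero whichever way the
condition falls. -/
theorem sum_ite_rate_lt_eq {U S : Type*} [Fintype U] [Fintype S] {q : U → S → ℝ}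
    (hq : ∀ u s, 0 ≤ q u s) {n : ℕ} (hn : 0 < n) (b : ℝ) :
    ∑ u, ∑ s, (if b < 1 / (n : ℝ) * Real.logb 2 (q u s / ((∑ s', q u s') * (∑ u', q u' s)))
        then q u s else 0)
      = ∑ u, ∑ s, if (2 : ℝ) ^ ((n : ℝ) * b) < likelihoodRatio q u s then q u s else 0 := by
  have hn' : (0 : ℝ) < n := by exact_mod_cast hn
  refine Finset.sum_congr rfl fun u _ => Finset.sum_congr rfl fun s _ => ?_
  rcases (hq u s).eq_or_lt with h | h
  · simp [← h]
  · have hr : 0 < likelihoodRatio q u s := by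
      refine (likelihoodRatio_nonneg hq u s).lt_of_ne fun h0 => ?_
      have := marginals_mul_likelihoodRatio hq u s
      rw [← h0] at this
      simp only [mul_zero] at this
      linarith
    rw [← likelihoodRatio]
    refine if_congr ?_ rfl rfl
    rw [← Real.lt_logb_iff_rpow_lt (by norm_num) hr, one_div, ← div_eq_inv_mul, lt_div_iff₀ hn',
      mul_comm]

/-- A likelihood ratio exceeds `t` with probability at least `1 - t`. -/
theorem one_le_sum_ite_add {U S : Type*} [Fintype U] [Fintype S] {q : U → S → ℝ}
    (hq : ∀ u s, 0 ≤ q u s) (hq1 : ∑ u, ∑ s, q u s = 1) {t : ℝ} (ht : 0 ≤ t) :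
    1 ≤ ∑ u, ∑ s, (if t < likelihoodRatio q u s then q u s else 0) + t := by
  have hp : ∀ u, 0 ≤ ∑ s, q u s := fun u => Finset.sum_nonneg fun s _ => hq u s
  have hs : ∀ s, 0 ≤ ∑ u, q u s := fun s => Finset.sum_nonneg fun u _ => hq u s
  have hle : ∀ u s, q u s - (if t < likelihoodRatio q u s then q u s else 0)
      ≤ t * ((∑ s', q u s') * ∑ u', q u' s) := by
    intro u s
    rw [← marginals_mul_truncRatio hq]
    have htr : truncRatio q t u s ≤ t := by
      unfold truncRatio; split_ifs with h
      · exact ht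
      · exact not_lt.mp h
    calc _ = truncRatio q t u s * ((∑ s', q u s') * ∑ u', q u' s) := by ring
      _ ≤ _ := mul_le_mul_of_nonneg_right htr (mul_nonneg (hp u) (hs s))
  have h := Finset.sum_le_sum fun u (_ : u ∈ Finset.univ) =>
    Finset.sum_le_sum fun s (_ : s ∈ Finset.univ) => hle u s
  simp only [Finset.sum_sub_distrib, ← Finset.mul_sum] at h
  rw [hq1, Finset.sum_comm (f := fun s u => q u s)] at h
  simp only [hq1, mul_one] at h
  linarith

theorem exists_le_of_GPAchievable
    {ρ : ∀ n, (Fin n → X) → (Fin n → S) → Matrix (Fin n → B) (Fin n → B) ℂ}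
    {pS : ∀ n, (Fin n → S) → ℝ} [Nonempty X]
    (hρ : ∀ n x s, IsDensity (ρ n x s)) (hS : ∀ n, pS n ∈ stdSimplex ℝ (Fin n → S)) {R : ℝ}
    (hR : GPAchievable ρ pS R) :
    ∃ a : ∀ n : ℕ, AuxInput X S n,
      (R : EReal) ≤ spectralInfMI (fun n => reduceUB ((a n).theta (ρ n) (pS n))) -
        spectralSupMI (fun n => (a n).jointUS (pS n)) := by
  classical
  obtain ⟨e, he, hG⟩ := exists_tendsto_zero_of_forall_eventually
    (G := fun n ε => ∃ (M : ℕ) (C : GPCode X S B n M), 0 < M ∧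
      R < 1 / (n : ℝ) * Real.logb 2 M ∧ C.error (ρ n) (pS n) ≤ ε) (fun ε hε => by
    obtain ⟨M, e, c, hM, herr, hrate, hlim⟩ := hR ε hε
    filter_upwards [eventually_lt_of_lt_liminf hrate, eventually_lt_of_limsup_lt hlim]
      with n h1 h2
    exact ⟨M n, c n, hM n, EReal.coe_lt_coe_iff.mp h1,
      (herr n).trans (EReal.coe_lt_coe_iff.mp h2).le⟩)
  have hex : ∀ n, ∃ (a : AuxInput X S n) (M : ℕ),
      (∃ (M : ℕ) (C : GPCode X S B n M), 0 < M ∧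
        R < 1 / (n : ℝ) * Real.logb 2 M ∧ C.error (ρ n) (pS n) ≤ e n) →
      0 < M ∧ R < 1 / (n : ℝ) * Real.logb 2 M ∧
      (∀ u s, a.jointUS (pS n) u s = pS n s / a.k) ∧ ∀ c : ℝ, 0 ≤ c →
        1 - e n - c / M ≤ (cqProj (fun u => ∑ s, a.jointUS (pS n) u s)
          (condState (a.jointUS (pS n)) (a.channel (ρ n))) c
          * cqState (fun u => ∑ s, a.jointUS (pS n) u s)
            (condState (a.jointUS (pS n)) (a.channel (ρ n)))).trace.re := by
    intro n
    by_cases h : ∃ (M : ℕ) (C : GPCode X S B n M), 0 < M ∧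
        R < 1 / (n : ℝ) * Real.logb 2 M ∧ C.error (ρ n) (pS n) ≤ e n
    · obtain ⟨M, C, hM, hr, herr⟩ := h
      obtain ⟨a, ha, ha'⟩ := exists_auxInput_of_gpCode hM C (hS n) (hρ n)
      exact ⟨a, M, fun _ => ⟨hM, hr, ha, fun c hc => le_trans (by linarith) (ha' c hc)⟩⟩
    · exact ⟨⟨1, fun _ => Pi.single 0 1, fun _ => single_mem_stdSimplex ℝ _,
        fun _ _ => Pi.single (Classical.arbitrary _) 1, fun _ _ => single_mem_stdSimplex ℝ _⟩, 0,
        fun h' => absurd h' h⟩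
  choose a M haM using hex
  refine ⟨a, ?_⟩
  have h1 : (R : EReal) ≤ spectralInfMI (fun n => reduceUB ((a n).theta (ρ n) (pS n))) := by
    simp only [fun n => (a n).reduceUB_theta (ρ := ρ n) (hS n).1]
    refine le_sSup ⟨R, fun γ hγ => ?_, rfl⟩
    refine tendsto_accept (e := e) (M := M) (R := R) hγ (fun n => ?_) he ?_
    · have hq := (a n).jointUS_nonneg (hS n).1
      have hσ := fun u s => (a n).channel_isDensity (hρ n) u s
      exact trace_cqProj_mul_le_one (fun u => Finset.sum_nonneg fun s _ => hq u s)
        ((a n).sum_sum_jointUS (hS n).2) (condState_posSemidef hq hσ) (mul_trace_condState hσ) _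
    · filter_upwards [hG] with n hn
      obtain ⟨h1, h2, _, h3⟩ := haM n hn
      exact ⟨h1, h2, h3 _ (by positivity)⟩
  have h2 : spectralSupMI (fun n => (a n).jointUS (pS n)) ≤ ((0 : ℝ) : EReal) := by
    refine sInf_le ⟨0, fun γ hγ => ?_, rfl⟩
    refine tendsto_const_nhds.congr' ?_
    filter_upwards [hG] with n hn
    obtain ⟨_, _, hj, _⟩ := haM n hn
    refine (Finset.sum_eq_zero fun u _ => Finset.sum_eq_zero fun s _ => if_neg ?_).symm
    have hk : ((a n).k : ℝ) ≠ 0 := by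
      have := u.pos
      positivity
    -- By independence the ratio is one where the state has positive mass; elsewhere it is 0/0 = 0,
    -- whose `Real.logb` is also 0.
    have hlog : Real.logb 2 ((a n).jointUS (pS n) u s /
        ((∑ s', (a n).jointUS (pS n) u s') * ∑ u', (a n).jointUS (pS n) u' s)) = 0 := by
      rw [(a n).sum_jointUS]
      simp only [hj, ← Finset.sum_div, (hS n).2]
      by_cases h0 : pS n s = 0
      · simp [h0]
      · rw [show pS n s / ((a n).k : ℝ) / (1 / ((a n).k : ℝ) * pS n s) = 1 by field_simp,
          Real.logb_one]
    rw [hlog, mul_zero, zero_add]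
    exact not_lt.mpr hγ.le
  calc (R : EReal) = (R : EReal) - ((0 : ℝ) : EReal) := by simp
    _ ≤ _ := EReal.sub_le_sub h1 h2

theorem GPAchievable_of_lt [Nonempty X]
    {ρ : ∀ n, (Fin n → X) → (Fin n → S) → Matrix (Fin n → B) (Fin n → B) ℂ}
    {pS : ∀ n, (Fin n → S) → ℝ}
    (hρ : ∀ n x s, IsDensity (ρ n x s)) (hS : ∀ n, pS n ∈ stdSimplex ℝ (Fin n → S))
    (a : ∀ n : ℕ, AuxInput X S n) {R : ℝ}
    (hR : (R : EReal) < spectralInfMI (fun n => reduceUB ((a n).theta (ρ n) (pS n))) -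
      spectralSupMI (fun n => (a n).jointUS (pS n))) :
    GPAchievable ρ pS R := by
  rcases lt_or_ge R 0 with h0 | h0
  · exact GPAchievable_of_neg ρ pS h0
  rw [EReal.lt_sub_iff_add_lt (.inr (EReal.coe_ne_top R)) (.inr (EReal.coe_ne_bot R))] at hR
  simp only [fun n => (a n).reduceUB_theta (ρ := ρ n) (hS n).1] at hR
  obtain ⟨_, ⟨i, hi, rfl⟩, hRi⟩ := lt_sSup_iff.mp hR
  rw [add_comm, ← EReal.lt_sub_iff_add_lt (.inl (EReal.coe_ne_bot R))
    (.inl (EReal.coe_ne_top R)), ← EReal.coe_sub] at hRi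
  obtain ⟨_, ⟨b, hb, rfl⟩, hbi⟩ := sInf_lt_iff.mp hRi
  have hbi := EReal.coe_lt_coe_iff.mp hbi
  have hq := fun n => (a n).jointUS_nonneg (hS n).1
  have hq1 := fun n => (a n).sum_sum_jointUS (hS n).2
  have hpr : ∀ γ : ℝ, 0 < γ → Tendsto (fun n : ℕ => ∑ u, ∑ s,
      if (2 : ℝ) ^ ((n : ℝ) * (b + γ)) < likelihoodRatio ((a n).jointUS (pS n)) u s
        then (a n).jointUS (pS n) u s else 0) atTop (𝓝 0) := fun γ hγ => by
    refine (hb γ hγ).congr' ?_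
    filter_upwards [eventually_gt_atTop 0] with n hn
    exact sum_ite_rate_lt_eq (hq n) hn (b + γ)
  -- If b < 0, the ratio would exceed 2^{nb/2} with vanishing probability, whereas that probability
  -- is at least 1 − 2^{nb/2}.
  have hb0 : 0 ≤ b := by
    by_contra! hb0
    have h1 := (hpr (-b / 2) (by linarith)).add (tendsto_two_rpow_neg (γ := -b / 2) (by linarith))
    rw [add_zero] at h1
    refine absurd (ge_of_tendsto' h1 fun n => ?_) (not_le.mpr one_pos)
    have := one_le_sum_ite_add (hq n) (hq1 n)
      (t := (2 : ℝ) ^ ((n : ℝ) * (b + -b / 2))) (by positivity)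
    rwa [show b + -b / 2 = -(-b / 2) by ring] at this ⊢
  -- Exponents: R + γ for M, b + 3γ for L, b + γ for t, −γ for η, i − γ for c. Then t/(Lη) and ML/c
  -- both decay like 2^{−nγ}, using six parts of the gap i − R − b.
  obtain ⟨γ, hγ, hγ'⟩ : ∃ γ : ℝ, 0 < γ ∧ (R + γ + (b + 3 * γ)) - (i - γ) = -γ :=
    ⟨(i - R - b) / 6, by linarith, by ring⟩
  have hz := hi γ hγ
  have hcode := fun n : ℕ => exists_gpCode_error_le (a n) (hS n) (hρ n)
    (c := (2 : ℝ) ^ ((n : ℝ) * (i - γ))) (t := (2 : ℝ) ^ ((n : ℝ) * (b + γ)))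
    (η := (2 : ℝ) ^ ((n : ℝ) * (-γ))) (by positivity) (by positivity) (by positivity)
    (δ := 1 / ((n : ℝ) + 1)) (by positivity) (ceil_two_rpow_pos ((n : ℝ) * (R + γ)))
    (ceil_two_rpow_pos ((n : ℝ) * (b + 3 * γ)))
  choose C hC using hcode
  have hlim : Tendsto (fun n : ℕ => (∑ u, ∑ s,
      (if (2 : ℝ) ^ ((n : ℝ) * (b + γ)) < likelihoodRatio ((a n).jointUS (pS n)) u s
        then (a n).jointUS (pS n) u s else 0)
      + (2 : ℝ) ^ ((n : ℝ) * (-γ)) + (2 : ℝ) ^ ((n : ℝ) * (-γ)))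
      + (2 * (1 - (cqProj (fun u => ∑ s, (a n).jointUS (pS n) u s)
          (condState ((a n).jointUS (pS n)) ((a n).channel (ρ n)))
          ((2 : ℝ) ^ ((n : ℝ) * (i - γ))) * cqState (fun u => ∑ s, (a n).jointUS (pS n) u s)
            (condState ((a n).jointUS (pS n)) ((a n).channel (ρ n)))).trace.re)
      + 4 * (4 * (2 : ℝ) ^ ((n : ℝ) * (-γ))) + 4 * (1 / ((n : ℝ) + 1)))) atTop (𝓝 0) := by
    have h1 := (tendsto_const_nhds (x := (1 : ℝ))).sub hz |>.const_mul 2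
    have h2 := ((tendsto_two_rpow_neg hγ).const_mul 4).const_mul 4
    have h3 := (tendsto_one_div_add_atTop_nhds_zero_nat (𝕜 := ℝ)).const_mul 4
    have h4 := ((hpr γ hγ).add (tendsto_two_rpow_neg hγ)).add (tendsto_two_rpow_neg hγ)
    have h := h4.add ((h1.add h2).add h3)
    simp only [sub_self, mul_zero, add_zero] at h
    exact h
  intro ε hε
  refine ⟨_, _, C, fun n => ceil_two_rpow_pos _, fun n => (hC n).trans ?_,
    lt_liminf_rate (by linarith), limsup_coe_lt hlim hε⟩
  have hM := ceil_two_rpow_le (by positivity : 0 ≤ (n : ℝ) * (R + γ))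
  have hL := ceil_two_rpow_le (by positivity : 0 ≤ (n : ℝ) * (b + 3 * γ))
  -- The constant 4 is a factor 2 from each of the two ceilings.
  have hML : ((⌈(2 : ℝ) ^ ((n : ℝ) * (R + γ))⌉₊ * ⌈(2 : ℝ) ^ ((n : ℝ) * (b + 3 * γ))⌉₊ : ℕ) : ℝ)
      ≤ 4 * (2 : ℝ) ^ ((n : ℝ) * (R + γ + (b + 3 * γ))) := by
    have e : (2 : ℝ) ^ ((n : ℝ) * (R + γ + (b + 3 * γ)))
        = (2 : ℝ) ^ ((n : ℝ) * (R + γ)) * (2 : ℝ) ^ ((n : ℝ) * (b + 3 * γ)) := by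
      rw [← Real.rpow_add (by norm_num), ← mul_add]
    rw [Nat.cast_mul, e]
    calc _ ≤ _ := mul_le_mul hM hL (by positivity) (by positivity)
      _ = _ := by ring
  have h1 := two_rpow_product_le hML hγ'
  have h2 : (2 : ℝ) ^ ((n : ℝ) * (b + γ)) / ((⌈(2 : ℝ) ^ ((n : ℝ) * (b + 3 * γ))⌉₊ : ℝ)
      * (2 : ℝ) ^ ((n : ℝ) * (-γ))) ≤ (2 : ℝ) ^ ((n : ℝ) * (-γ)) := by
    have hpos : (0 : ℝ) < ⌈(2 : ℝ) ^ ((n : ℝ) * (b + 3 * γ))⌉₊ := by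
      exact_mod_cast ceil_two_rpow_pos _
    rw [div_le_iff₀ (by positivity)]
    calc (2 : ℝ) ^ ((n : ℝ) * (b + γ))
        = (2 : ℝ) ^ ((n : ℝ) * (-γ)) * ((2 : ℝ) ^ ((n : ℝ) * (b + 3 * γ))
          * (2 : ℝ) ^ ((n : ℝ) * (-γ))) := by
          rw [← Real.rpow_add (by norm_num), ← Real.rpow_add (by norm_num)]; ring_nf
      _ ≤ _ := by gcongr; exact Nat.le_ceil _
  linarith

theorem gpCapacity_eq [Nonempty X]
    {ρ : ∀ n, (Fin n → X) → (Fin n → S) → Matrix (Fin n → B) (Fin n → B) ℂ}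
    {pS : ∀ n, (Fin n → S) → ℝ}
    (hρ : ∀ n x s, IsDensity (ρ n x s)) (hS : ∀ n, pS n ∈ stdSimplex ℝ (Fin n → S)) :
    gpCapacity ρ pS = ⨆ a : ∀ n : ℕ, AuxInput X S n,
      (spectralInfMI (fun n => reduceUB ((a n).theta (ρ n) (pS n))) -
        spectralSupMI (fun n => (a n).jointUS (pS n))) := by
  refine le_antisymm (sSup_le ?_) (iSup_le fun a => ?_)
  · rintro _ ⟨R, hR, rfl⟩
    obtain ⟨a, ha⟩ := exists_le_of_GPAchievable hρ hS hR
    exact ha.trans (le_iSup (fun a : ∀ n : ℕ, AuxInput X S n =>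
      spectralInfMI (fun n => reduceUB ((a n).theta (ρ n) (pS n))) -
        spectralSupMI (fun n => (a n).jointUS (pS n))) a)
  · by_contra! h
    obtain ⟨R, h1, h2⟩ := EReal.lt_iff_exists_real_btwn.mp h
    have h3 : (R : EReal) ≤ gpCapacity ρ pS := le_sSup ⟨R, GPAchievable_of_lt hρ hS a h2, rfl⟩
    exact absurd h3 (not_le.mpr h1)

end Capacity

end CQ

theorem corollary1 {X S B : Type*} [Fintype X] [DecidableEq X] [Nonempty X]
    [Fintype S] [DecidableEq S] [Fintype B] [DecidableEq B] :
    (∀ ρ : ∀ n : ℕ, (Fin n → X) → Matrix (Fin n → B) (Fin n → B) ℂ,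
      (∀ n x, CQ.IsDensity (ρ n x)) →
      CQ.cqCapacity ρ =
        ⨆ p : ∀ n : ℕ, stdSimplex ℝ (Fin n → X),
          CQ.spectralInfMI (fun n => CQ.cqState (p n : (Fin n → X) → ℝ) (ρ n))) ∧
    (∀ (ρ : ∀ n : ℕ, (Fin n → X) → (Fin n → S) → Matrix (Fin n → B) (Fin n → B) ℂ)
      (pS : ∀ n : ℕ, (Fin n → S) → ℝ),
      (∀ n x s, CQ.IsDensity (ρ n x s)) → (∀ n, pS n ∈ stdSimplex ℝ (Fin n → S)) →
      CQ.gpCapacity ρ pS =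
        ⨆ a : ∀ n : ℕ, CQ.AuxInput X S n,
          (CQ.spectralInfMI (fun n => CQ.reduceUB ((a n).theta (ρ n) (pS n))) -
            CQ.spectralSupMI (fun n => (a n).jointUS (pS n)))) :=
  ⟨fun _ hρ => CQ.cqCapacity_eq hρ, fun _ _ hρ hS => CQ.gpCapacity_eq hρ hS⟩
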